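/- All graphs are finite and simple. For graphs $H,G$ let $\hom(H,G)$ be the number of homomorphisms from $H$ to $G$, let $\mathrm{inj}(H,G)$ be the number of injective homomorphisms from $H$ to $G$, and let $\mathrm{ind}(H,G)$ be the number of isomorphisms from $H$ to induced subgraphs of $G$ (that is, of injective maps $V(H)\to V(G)$ that preserve both adjacency and non-adjacency). For a fixed graph $H$, let $\textsc{hom-cnt}_H$, $\textsc{inj-cnt}_H$ and $\textsc{ind-cnt}_H$ be the problems of computing $\hom(H,G)$, $\mathrm{inj}(H,G)$ and $\mathrm{ind}(H,G)$, respectively, for a given input graph $G$. A graph $G$ is $\kappa$-degenerate if its vertices can be ordered $v_1,\dots,v_n$ so that each $v_i$ has at most $\kappa$ neighbours in $\{v_{i+1},\dots,v_n\}$. Such a problem is called easy if there are a Las Vegas randomized algorithm (one whose output is always correct when it halts) in the word RAM model with words of $O(\log n)$ bits and a function $f:\mathbb{N}\to\mathbb{N}$ (both of which may depend on the problem, hence on $H$) such that, for all $\kappa\ge 0$ and $n\ge 1$ and every $\kappa$-degenerate input graph $G$ with $n$ vertices, given by $n$ and a list of its edges, the algorithm solves the problem on $G$ in expected time at most $f(\kappa)\cdot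 n$. A supergraph of $H$ is a graph $H'$ with $V(H')=V(H)$ and $E(H)\subseteq E(H')$. **Lemma.** For every graph $H$, the following are equivalent. 1. $\textsc{ind-cnt}_H$ is easy. 2. $\textsc{inj-cnt}_{H'}$ is easy for every supergraph $H'$ of $H$. 3. $\textsc{hom-cnt}_{H'}$ is easy for every supergraph $H'$ of $H$. -/

import Mathlib

open scoped ENNReal

/-! ## A randomized word RAM

Programs are given in structured form (sequencing, branching, `while`-loops) over a
countable supply of registers, of which a program names only finitely many, and a
random access memory.  Every elementary step costs one unit of time. -/

namespace WordRAM

/-- Unit-cost operations on words.  `sub` is truncated subtraction, division by zero gives zero. -/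
inductive Op where
  | add | sub | mul | div | mod | and | or | xor | shl | shr

/-- The result of an operation, computed without wrap-around.  That all results fit into a word
is demanded separately, see `FitsWords`. -/
def Op.eval : Op → ℕ → ℕ → ℕ
  | .add, a, b => a + b
  | .sub, a, b => a - b
  | .mul, a, b => a * b
  | .div, a, b => a / b
  | .mod, a, b => a % b
  | .and, a, b => a &&& b
  | .or, a, b => a ||| b
  | .xor, a, b => a ^^^ b
  | .shl, a, b => a <<< b
  | .shr, a, b => a >>> b

/-- Programs.  Register indices and constants are part of the program text; memory addresses
are computed at run time. -/
inductive Prog where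
  /-- do nothing -/
  | skip
  /-- `reg d := k` -/
  | const (d k : ℕ)
  /-- `reg d := reg a ∘ reg b` -/
  | op (o : Op) (d a b : ℕ)
  /-- `reg d := mem (reg a)` -/
  | load (d a : ℕ)
  /-- `mem (reg a) := reg s` -/
  | store (a s : ℕ)
  /-- `reg d :=` a fresh, uniformly random element of `{0, …, reg a}` -/
  | rand (d a : ℕ)
  /-- first `p`, then `q` -/
  | seq (p q : Prog)
  /-- `p` if `reg r ≠ 0`, and `q` otherwise -/
  | ite (r : ℕ) (p q : Prog)
  /-- `while reg r ≠ 0 do p` -/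
  | loop (r : ℕ) (p : Prog)

/-- The contents of the registers and of the memory. -/
structure State where
  reg : ℕ → ℕ
  mem : ℕ → ℕ

/-- The state with `reg d` overwritten by `x`. -/
def State.setReg (s : State) (d x : ℕ) : State :=
  { s with reg := Function.update s.reg d x }

/-- The state with `mem a` overwritten by `x`. -/
def State.setMem (s : State) (a x : ℕ) : State :=
  { s with mem := Function.update s.mem a x }

/-- A configuration: the program pieces that remain to be executed, in this order, and the
current state.  The machine has halted when nothing remains to be executed. -/
structure Config where
  todo : List Prog
  state : State

/-- One step of computation, as a probability distribution on the next configuration. -/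
noncomputable def step : Config → PMF Config
  | ⟨[], s⟩ => PMF.pure ⟨[], s⟩
  | ⟨.skip :: k, s⟩ => PMF.pure ⟨k, s⟩
  | ⟨.const d x :: k, s⟩ => PMF.pure ⟨k, s.setReg d x⟩
  | ⟨.op o d a b :: k, s⟩ => PMF.pure ⟨k, s.setReg d (o.eval (s.reg a) (s.reg b))⟩
  | ⟨.load d a :: k, s⟩ => PMF.pure ⟨k, s.setReg d (s.mem (s.reg a))⟩
  | ⟨.store a b :: k, s⟩ => PMF.pure ⟨k, s.setMem (s.reg a) (s.reg b)⟩
  | ⟨.rand d a :: k, s⟩ =>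
      (PMF.uniformOfFintype (Fin (s.reg a + 1))).map fun x => ⟨k, s.setReg d x⟩
  | ⟨.seq p q :: k, s⟩ => PMF.pure ⟨p :: q :: k, s⟩
  | ⟨.ite r p q :: k, s⟩ => PMF.pure ⟨(if s.reg r ≠ 0 then p else q) :: k, s⟩
  | ⟨.loop r p :: k, s⟩ =>
      PMF.pure ⟨if s.reg r ≠ 0 then p :: .loop r p :: k else k, s⟩

/-- The distribution of the configuration after `t` steps (a halted machine stays put). -/
noncomputable def runFor : ℕ → Config → PMF Config
  | 0, c => PMF.pure c
  | t + 1, c => (step c).bind (runFor t)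

/-- The expected running time `𝔼[T] = ∑ₜ Pr[T > t]`, where `T` is the number of steps until the
machine halts; it is `∞` if, for example, the machine fails to halt with positive probability. -/
noncomputable def expectedTime (c : Config) : ℝ≥0∞ :=
  ∑' t : ℕ, (runFor t c).toOuterMeasure {x | x.todo ≠ []}

/-- `x` occurs with positive probability in the run that starts in `c`. -/
def Reachable (c x : Config) : Prop :=
  ∃ t : ℕ, x ∈ (runFor t c).support

/-- In no run from `c` does a register or a memory cell ever hold a number `≥ B`. -/
def FitsWords (B : ℕ) (c : Config) : Prop :=
  ∀ x, Reachable c x → ∀ i, x.state.reg i < B ∧ x.state.mem i < B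

/-- Whenever the machine halts in a run from `c`, register `0` holds the number `y`. -/
def Outputs (c : Config) (y : ℕ) : Prop :=
  ∀ x, Reachable c x → x.todo = [] → x.state.reg 0 = y

/-- Start of the program `p`: all registers are zero, and the memory holds the given list of
numbers, followed by zeros. -/
def start (p : Prog) (input : List ℕ) : Config :=
  ⟨[p], ⟨fun _ => 0, fun i => input.getD i 0⟩⟩

end WordRAM

/-! ## Input graphs and linear-time solvability -/

namespace SubgraphCount

/-- `L` lists every edge of `G` exactly once (in any order, with endpoints in any order). -/
def IsEdgeList {n : ℕ} (G : SimpleGraph (Fin n)) (L : List (Fin n × Fin n)) : Prop :=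
  (L.map fun e => s(e.1, e.2)).Nodup ∧
    ∀ u v, G.Adj u v ↔ s(u, v) ∈ L.map fun e => s(e.1, e.2)

/-- The input given to an algorithm: the number of vertices, the number of edges, and then the
two endpoints of every edge. -/
def encode (n : ℕ) (L : List (Fin n × Fin n)) : List ℕ :=
  n :: L.length :: L.flatMap fun e => [(e.1 : ℕ), (e.2 : ℕ)]

/-- `G` is `κ`-degenerate: its vertices can be ordered so that each vertex has at most `κ`
neighbours after it.  Here `σ v` is the position of `v`. -/
def IsDegenerate {n : ℕ} (κ : ℕ) (G : SimpleGraph (Fin n)) : Prop :=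
  ∃ σ : Equiv.Perm (Fin n), ∀ v, {w | G.Adj v w ∧ σ v < σ w}.ncard ≤ κ

/-- The problem of computing the graph parameter `count` is *easy*: some randomized word RAM
program with words of `c * log₂ (n + 1)` bits, on every representation of every `n`-vertex graph
(`n ≥ 1`), always gives the correct output if it halts, and has expected running time at
most `f κ * n` if the graph is `κ`-degenerate.  The program, `c` and `f` do not depend on the
graph, and the program and `c` do not depend on `κ`. -/
def IsEasy (count : ∀ n : ℕ, SimpleGraph (Fin n) → ℕ) : Prop :=
  ∃ (p : WordRAM.Prog) (c : ℕ) (f : ℕ → ℕ),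
    ∀ (n : ℕ), 1 ≤ n → ∀ (G : SimpleGraph (Fin n)) (L : List (Fin n × Fin n)),
      IsEdgeList G L →
        WordRAM.FitsWords ((n + 1) ^ c) (WordRAM.start p (encode n L)) ∧
        WordRAM.Outputs (WordRAM.start p (encode n L)) (count n G) ∧
        ∀ κ : ℕ, IsDegenerate κ G →
          WordRAM.expectedTime (WordRAM.start p (encode n L)) ≤ (f κ : ℝ≥0∞) * (n : ℝ≥0∞)

/-- The number of homomorphisms from `H` to `G`. -/
noncomputable def hom {V W : Type*} (H : SimpleGraph V) (G : SimpleGraph W) : ℕ :=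
  Nat.card (H →g G)

/-- The number of injective homomorphisms from `H` to `G`. -/
noncomputable def inj {V W : Type*} (H : SimpleGraph V) (G : SimpleGraph W) : ℕ :=
  Nat.card {φ : H →g G // Function.Injective φ}

/-- The number of isomorphisms from `H` to induced subgraphs of `G`, i.e. of injective maps
that preserve both adjacency and non-adjacency. -/
noncomputable def ind {V W : Type*} (H : SimpleGraph V) (G : SimpleGraph W) : ℕ :=
  Nat.card (H ↪g G)

/-- The problem of computing `hom H G` for a given input graph `G` is easy. -/
def HomEasy {V : Type*} (H : SimpleGraph V) : Prop :=
  IsEasy fun _ G => hom H G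

/-- The problem of computing `inj H G` for a given input graph `G` is easy. -/
def InjEasy {V : Type*} (H : SimpleGraph V) : Prop :=
  IsEasy fun _ G => inj H G

/-- The problem of computing `ind H G` for a given input graph `G` is easy. -/
def IndEasy {V : Type*} (H : SimpleGraph V) : Prop :=
  IsEasy fun _ G => ind H G

end SubgraphCount

/-! All three kinds of counts are integer combinations of one another, up to smaller graphs.
Inclusion–exclusion over the non-edges of `H` gives `ind H = ∑ (-1)^|S| inj (H + S)`, which is 2 → 1
(`indParam_eq`). Sorting homomorphisms by their kernel gives `hom K = ∑ inj (K/π)` over the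
partitions into independent classes. Solving for the trivial partition expresses `inj K` as `hom K`
plus a combination of homomorphism counts of smaller graphs (`injParam_sub_homParam_mem`).

The difficulty is to recover one homomorphism count from an easy combination. If `P` is a symmetric
relation on a fixed finite set, the product of `G` with `P` has linear size and bounded degeneracy,
and `hom(K, G × P) = hom(K, G) · hom(K, P)`. Subtracting a multiple of the original combination from
its value at `G × P` cancels any term that homomorphism counts to `P` tell from the target
(`homEasy_of_mem_easyGroup`). What remains is the target times the sum of the coefficients of the
terms that no `P` tells from it, and this sum must not vanish.

For 1 → 3, indistinguishable graphs have equally many vertices and edges (Lovász's argument,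
`exists_surjective_hom`), so the corresponding supergraphs enter `ind H` with the same sign. For 3 →
2, the quotients of supergraphs are needed too. Any surjective homomorphic image `Q` of `H` is a
quotient of the supergraph `K` in which the fibers are made cliques. The product of `G` with a
complete graph in which each copy is itself completed counts maps that may contract edges of `K`.
This is a sum of homomorphism counts of contractions of `K`, among them `Q`, and all coefficients
are positive (`homEasy_of_surjective`).

On the machine side, everything rests on `IsEasy.op`: two easy parameters, each evaluated on a
product of the input, can be combined by an arithmetic operation. The two subroutines use registers
and memory cells of opposite parity, registers below 16 are left to the calling program, and the
input stays intact below both work areas. -/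

namespace WordRAM

/-! ### Time, word bound and correctness as a single expected cost -/

/-- Every register and every memory cell holds a number below `B`. -/
def State.Fits (B : ℕ) (s : State) : Prop := ∀ i, s.reg i < B ∧ s.mem i < B

theorem State.Fits.setReg {B : ℕ} {s : State} (h : s.Fits B) {d x : ℕ} (hx : x < B) :
    (s.setReg d x).Fits B := by
  intro i
  refine ⟨?_, (h i).2⟩
  by_cases hi : i = d
  · subst hi; simpa [State.setReg] using hx
  · simpa [State.setReg, hi] using (h i).1

theorem State.Fits.setMem {B : ℕ} {s : State} (h : s.Fits B) {a x : ℕ} (hx : x < B) :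
    (s.setMem a x).Fits B := by
  intro i
  refine ⟨(h i).1, ?_⟩
  by_cases hi : i = a
  · subst hi; simpa [State.setMem] using hx
  · simpa [State.setMem, hi] using (h i).2

open Classical in
/-- The cost of one unit of time spent in a configuration: infinite if the configuration violates
the word bound or has halted with an output other than `y`. -/
noncomputable def stepCost (B y : ℕ) (c : Config) : ℝ≥0∞ :=
  if ¬ c.state.Fits B ∨ (c.todo = [] ∧ c.state.reg 0 ≠ y) then ⊤
  else if c.todo = [] then 0 else 1

/-- The expected cost of the first `N` steps. -/
noncomputable def costFor (B y : ℕ) : ℕ → Config → ℝ≥0∞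
  | 0, _ => 0
  | N + 1, c => stepCost B y c + ∑' c', step c c' * costFor B y N c'

/-- The total expected cost of a run. -/
noncomputable def cost (B y : ℕ) (c : Config) : ℝ≥0∞ := ⨆ N, costFor B y N c

theorem tsum_pure_mul (c : Config) (f : Config → ℝ≥0∞) : ∑' x, PMF.pure c x * f x = f c := by
  rw [tsum_eq_single c]
  · simp
  · intro b hb; simp [hb]

theorem tsum_map_mul {α : Type*} (p : PMF α) (g : α → Config) (f : Config → ℝ≥0∞) :
    ∑' x, p.map g x * f x = ∑' a, p a * f (g a) := by
  rw [← PMF.bind_pure_comp]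
  simp only [PMF.bind_apply, ← ENNReal.tsum_mul_right]
  rw [ENNReal.tsum_comm]
  refine tsum_congr fun a => ?_
  simp only [mul_assoc, ENNReal.tsum_mul_left, Function.comp]
  rw [tsum_pure_mul]

theorem costFor_eq_sum (B y N : ℕ) (c : Config) :
    costFor B y N c = ∑ t ∈ Finset.range N, ∑' x, runFor t c x * stepCost B y x := by
  induction N generalizing c with
  | zero => simp [costFor]
  | succ N ih =>
    rw [Finset.sum_range_succ', costFor, add_comm]
    congr 1
    · simp only [ih, runFor, PMF.bind_apply, ← ENNReal.tsum_mul_right, Finset.mul_sum]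
      rw [Summable.tsum_finsetSum fun _ _ => ENNReal.summable]
      refine Finset.sum_congr rfl fun t _ => ?_
      simp only [← ENNReal.tsum_mul_left]
      rw [ENNReal.tsum_comm]
      simp only [mul_assoc]
    · simp [runFor]

theorem cost_eq_tsum (B y : ℕ) (c : Config) :
    cost B y c = ∑' t, ∑' x, runFor t c x * stepCost B y x := by
  rw [ENNReal.tsum_eq_iSup_nat]
  simp only [cost, costFor_eq_sum]

theorem costFor_mono (B y : ℕ) (c : Config) : Monotone fun N => costFor B y N c := by
  intro N M h
  simp only [costFor_eq_sum]
  exact Finset.sum_le_sum_of_subset (Finset.range_subset_range.2 h)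

theorem costFor_le_cost (B y N : ℕ) (c : Config) : costFor B y N c ≤ cost B y c :=
  le_iSup (fun N => costFor B y N c) N

theorem cost_eq (B y : ℕ) (c : Config) :
    cost B y c = stepCost B y c + ∑' c', step c c' * cost B y c' := by
  conv_lhs => rw [cost_eq_tsum, tsum_eq_zero_add' ENNReal.summable]
  congr 1
  · simp [runFor]
  · simp only [cost_eq_tsum, runFor, PMF.bind_apply, ← ENNReal.tsum_mul_right,
      ← ENNReal.tsum_mul_left]
    rw [ENNReal.tsum_comm (α := Config) (β := ℕ)]
    refine tsum_congr fun t => ?_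
    rw [ENNReal.tsum_comm]
    simp only [mul_assoc]

/-- A reachable configuration has positive probability at some time, so an infinite charge there
makes the whole expectation infinite. Finite cost therefore certifies the word bound and the output
at once. -/
theorem stepCost_ne_top {B y : ℕ} {c x : Config} (h : cost B y c ≠ ⊤)
    (hx : Reachable c x) : stepCost B y x ≠ ⊤ := by
  obtain ⟨t, ht⟩ := hx
  intro htop
  apply h
  rw [cost_eq_tsum]
  refine ENNReal.tsum_eq_top_of_eq_top ⟨t, ENNReal.tsum_eq_top_of_eq_top ⟨x, ?_⟩⟩
  rw [htop, ENNReal.mul_top]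
  exact (PMF.mem_support_iff _ _).1 ht

theorem fitsWords_of_cost_ne_top {B y : ℕ} {c : Config} (h : cost B y c ≠ ⊤) : FitsWords B c := by
  intro x hx
  by_contra hc
  exact stepCost_ne_top h hx (if_pos (Or.inl hc))

theorem outputs_of_cost_ne_top {B y : ℕ} {c : Config} (h : cost B y c ≠ ⊤) : Outputs c y := by
  intro x hx hnil
  by_contra hc
  exact stepCost_ne_top h hx (if_pos (Or.inr ⟨hnil, hc⟩))

theorem expectedTime_le_cost (B y : ℕ) (c : Config) : expectedTime c ≤ cost B y c := by
  rw [cost_eq_tsum]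
  refine ENNReal.tsum_le_tsum fun t => ?_
  rw [PMF.toOuterMeasure_apply]
  refine ENNReal.tsum_le_tsum fun x => ?_
  by_cases hx : x.todo = []
  · simp [Set.indicator, hx]
  · simp only [Set.indicator, Set.mem_ofPred_eq, hx, not_false_eq_true, if_true, stepCost, ne_eq]
    split_ifs
    · by_cases h0 : runFor t c x = 0
      · simp [h0]
      · rw [ENNReal.mul_top h0]; exact le_top
    · simp_all
    · simp

/-- On configurations of positive probability the infinite charge never applies, and the step cost
is the indicator of not having halted. -/
theorem cost_le_expectedTime {B y : ℕ} {c : Config} (hf : FitsWords B c) (ho : Outputs c y) :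
    cost B y c ≤ expectedTime c := by
  rw [cost_eq_tsum]
  refine ENNReal.tsum_le_tsum fun t => ?_
  rw [PMF.toOuterMeasure_apply]
  refine ENNReal.tsum_le_tsum fun x => ?_
  by_cases h0 : runFor t c x = 0
  · simp [h0]
  have hr : Reachable c x := ⟨t, (PMF.mem_support_iff _ _).2 h0⟩
  have hfx : x.state.Fits B := hf x hr
  by_cases hx : x.todo = []
  · simp [stepCost, hx, hfx, ho x hr hx]
  · simp [Set.indicator, stepCost, hx, hfx]

theorem cost_of_not_fits {B y : ℕ} {c : Config} (h : ¬ c.state.Fits B) : cost B y c = ⊤ := by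
  rw [cost_eq, stepCost, if_pos (Or.inl h), top_add]

theorem cost_of_wrong {B y : ℕ} {s : State} (h : s.reg 0 ≠ y) : cost B y ⟨[], s⟩ = ⊤ := by
  rw [cost_eq, stepCost, if_pos (Or.inr ⟨rfl, h⟩), top_add]

theorem cost_halted {B y : ℕ} {s : State} (hs : s.Fits B) (h : s.reg 0 = y) :
    cost B y ⟨[], s⟩ = 0 := by
  have : ∀ N, costFor B y N ⟨[], s⟩ = 0 := by
    intro N
    induction N with
    | zero => rfl
    | succ N ih => simp [costFor, stepCost, hs, h, step, ih]
  simp [cost, this]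

theorem stepCost_running {B y : ℕ} {p : Prog} {k : List Prog} {s : State} (hs : s.Fits B) :
    stepCost B y ⟨p :: k, s⟩ = 1 := by
  simp [stepCost, hs]

theorem cost_running {B y : ℕ} {p : Prog} {k : List Prog} {s : State} (hs : s.Fits B) :
    cost B y ⟨p :: k, s⟩ = 1 + ∑' c', step ⟨p :: k, s⟩ c' * cost B y c' := by
  rw [cost_eq, stepCost_running hs]

theorem cost_det {B y : ℕ} {p : Prog} {k : List Prog} {s : State} {c' : Config} (hs : s.Fits B)
    (h : step ⟨p :: k, s⟩ = PMF.pure c') : cost B y ⟨p :: k, s⟩ = 1 + cost B y c' := by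
  rw [cost_running hs, h, tsum_pure_mul]

theorem costFor_succ_det {B y N : ℕ} {p : Prog} {k : List Prog} {s : State} {c' : Config}
    (hs : s.Fits B) (h : step ⟨p :: k, s⟩ = PMF.pure c') :
    costFor B y (N + 1) ⟨p :: k, s⟩ = 1 + costFor B y N c' := by
  rw [costFor, stepCost_running hs, h, tsum_pure_mul]

theorem costFor_det_le {B y N : ℕ} {p : Prog} {k : List Prog} {s : State} {c' : Config}
    (hs : s.Fits B) (h : step ⟨p :: k, s⟩ = PMF.pure c') :
    costFor B y N ⟨p :: k, s⟩ ≤ 1 + costFor B y N c' :=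
  (costFor_mono B y _ N.le_succ).trans (costFor_succ_det hs h).le

end WordRAM

/-! ### Running a program as a subroutine in its own registers and cells -/

namespace WordRAM

/-- The register that stands for register `r` of the relocated program number `j`. -/
def relocReg (j r : ℕ) : ℕ := 16 + 2 * r + j

/-- The program `p`, working on the registers `relocReg j r` and on every other memory cell from the
address in register `2` on.  Register `1` holds the addresses. -/
def Prog.reloc (j : ℕ) : Prog → Prog
  | .skip => .skip
  | .const d x => .const (relocReg j d) x
  | .op o d a b => .op o (relocReg j d) (relocReg j a) (relocReg j b)
  | .load d a => .seq (.op .add 1 (relocReg j a) (relocReg j a))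
      (.seq (.op .add 1 1 2) (.load (relocReg j d) 1))
  | .store a b => .seq (.op .add 1 (relocReg j a) (relocReg j a))
      (.seq (.op .add 1 1 2) (.store 1 (relocReg j b)))
  | .rand d a => .rand (relocReg j d) (relocReg j a)
  | .seq p q => .seq (p.reloc j) (q.reloc j)
  | .ite r p q => .ite (relocReg j r) (p.reloc j) (q.reloc j)
  | .loop r p => .loop (relocReg j r) (p.reloc j)

/-- The state `s'` represents `s` in the registers `relocReg j r` and the cells `β + 2 * a`, and
agrees with `s₀` elsewhere, except for the first registers. -/
structure Represents (j β B : ℕ) (s₀ s s' : State) : Prop where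
  reg : ∀ r, s'.reg (relocReg j r) = s.reg r
  mem : ∀ a, s'.mem (β + 2 * a) = s.mem a
  base : s'.reg 2 = β
  fits : s'.Fits B
  otherReg : ∀ i, 16 ≤ i → (∀ r, i ≠ relocReg j r) → s'.reg i = s₀.reg i
  otherMem : ∀ x, (∀ a, x ≠ β + 2 * a) → s'.mem x = s₀.mem x

namespace Represents

variable {j β B : ℕ} {s₀ s s' : State}

theorem setReg (h : Represents j β B s₀ s s') (d : ℕ) {x : ℕ} (hx : x < B) :
    Represents j β B s₀ (s.setReg d x) (s'.setReg (relocReg j d) x) where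
  reg r := by
    by_cases hr : r = d
    · subst hr; simp [State.setReg]
    · have : relocReg j r ≠ relocReg j d := by unfold relocReg; omega
      simp [State.setReg, hr, this, h.reg]
  mem a := h.mem a
  base := by
    have : 2 ≠ relocReg j d := by unfold relocReg; omega
    simp [State.setReg, this, h.base]
  fits := h.fits.setReg hx
  otherReg i hi hr := by simp [State.setReg, hr d, h.otherReg i hi hr]
  otherMem x hx := h.otherMem x hx

theorem setAddr (h : Represents j β B s₀ s s') {x : ℕ} (hx : x < B) :
    Represents j β B s₀ s (s'.setReg 1 x) where
  reg r := by
    have : relocReg j r ≠ 1 := by unfold relocReg; omega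
    simp [State.setReg, this, h.reg]
  mem a := h.mem a
  base := by simp [State.setReg, h.base]
  fits := h.fits.setReg hx
  otherReg i hi hr := by
    have : i ≠ 1 := by omega
    simp [State.setReg, this, h.otherReg i hi hr]
  otherMem x hx := h.otherMem x hx

theorem setMem (h : Represents j β B s₀ s s') (a : ℕ) {x : ℕ} (hx : x < B) :
    Represents j β B s₀ (s.setMem a x) (s'.setMem (β + 2 * a) x) where
  reg r := h.reg r
  mem b := by
    by_cases hb : b = a
    · subst hb; simp [State.setMem]
    · have : β + 2 * b ≠ β + 2 * a := by omega
      simp [State.setMem, hb, h.mem]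
  base := h.base
  fits := h.fits.setMem hx
  otherReg := h.otherReg
  otherMem y hy := by simp [State.setMem, hy a, h.otherMem y hy]

end Represents

/-- The uniform distribution on `{0, …, n}`. -/
noncomputable def uniformUpTo (n : ℕ) : PMF ℕ := do
  let x ← PMF.uniformOfFintype (Fin (n + 1))
  pure (x : ℕ)

/-- Isolates the drawn number as a distribution on `ℕ` that depends on the state only through `s.reg
a`, so that equal register contents give equal distributions. -/
theorem step_rand (d a : ℕ) (k : List Prog) (s : State) :
    step ⟨.rand d a :: k, s⟩ = (uniformUpTo (s.reg a)).map fun x => ⟨k, s.setReg d x⟩ := rfl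

theorem costFor_halted_le {B y N : ℕ} {c : Config} {K L : ℝ≥0∞} (h : cost B y c ≤ K) :
    costFor B y N c ≤ L + K :=
  (costFor_le_cost B y N c).trans (h.trans le_add_self)

/-- The relocated program incurs at most five times the cost of the original one. -/
theorem costFor_reloc_le {j β B B' y y' : ℕ} (hB : β + 2 * B ≤ B') {s₀ : State} {k : List Prog}
    {K : ℝ≥0∞}
    (hK : ∀ s s', Represents j β B' s₀ s s' → s.Fits B → s.reg 0 = y → cost B' y' ⟨k, s'⟩ ≤ K)
    (N : ℕ) : ∀ (ks : List Prog) (s s' : State), Represents j β B' s₀ s s' →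
      costFor B' y' N ⟨ks.map (Prog.reloc j) ++ k, s'⟩ ≤ 5 * cost B y ⟨ks, s⟩ + K := by
  -- The factor 5 comes from `load` and `store`, whose relocation takes two `seq`, two additions and
  -- the access itself. It is nonzero, so it preserves infinite cost.
  have h5 : (5 : ℝ≥0∞) ≠ 0 := by norm_num
  -- Programs need not terminate, so the induction is on the number of steps for which the relocated
  -- program is observed.
  induction N with
  | zero => intro ks s s' _; exact zero_le
  | succ N ih =>
    intro ks s s' h
    -- If the original run leaves the word bound or halts with a wrong output, the right-hand side
    -- is infinite; only well-behaved states need simulation.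
    by_cases hs : s.Fits B
    swap
    · rw [cost_of_not_fits hs, ENNReal.mul_top h5, top_add]; exact le_top
    rcases ks with _ | ⟨p, ks⟩
    · by_cases hy : s.reg 0 = y
      · exact costFor_halted_le (hK s s' h hs hy)
      · rw [cost_of_wrong hy, ENNReal.mul_top h5, top_add]; exact le_top
    have hlt : ∀ {x}, x < B → x < B' := fun hx => by omega
    have det : ∀ {ks₁ : List Prog} {s₁ s₁' : State},
        step ⟨p :: ks, s⟩ = PMF.pure ⟨ks₁, s₁⟩ →
        step ⟨(p :: ks).map (Prog.reloc j) ++ k, s'⟩ =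
          PMF.pure ⟨ks₁.map (Prog.reloc j) ++ k, s₁'⟩ →
        (s₁.Fits B → Represents j β B' s₀ s₁ s₁') →
        costFor B' y' (N + 1) ⟨(p :: ks).map (Prog.reloc j) ++ k, s'⟩ ≤
          5 * cost B y ⟨p :: ks, s⟩ + K := by
      intro ks₁ s₁ s₁' h1 h2 h3
      rw [cost_det hs h1]
      by_cases hf : s₁.Fits B
      · have := ih ks₁ s₁ s₁' (h3 hf)
        rw [List.map_cons, List.cons_append] at h2 ⊢
        rw [costFor_succ_det h.fits h2, mul_add, add_assoc]
        refine add_le_add ?_ this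
        norm_num
      · rw [cost_of_not_fits hf, add_top, ENNReal.mul_top h5, top_add]; exact le_top
    have fit_reg : ∀ {d x : ℕ}, (s.setReg d x).Fits B → x < B := fun {d x} hf => by
      simpa [State.setReg] using (hf d).1
    have addr : ∀ a, β + 2 * s.reg a < B' := fun a => by have := (hs a).1; omega
    -- The address computation takes four steps. Only the first lowers the number of observed steps;
    -- the others use monotonicity in that number.
    have fetch : ∀ (a : ℕ) (q : Prog) (ks' : List Prog),
        costFor B' y' (N + 1) ⟨.seq (.op .add 1 (relocReg j a) (relocReg j a))
          (.seq (.op .add 1 1 2) q) :: ks', s'⟩ ≤ 4 + costFor B' y' N ⟨q :: ks',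
            (s'.setReg 1 (2 * s.reg a)).setReg 1 (β + 2 * s.reg a)⟩ := by
      intro a q ks'
      have hr := h.setAddr (x := 2 * s.reg a) (by have := addr a; omega)
      rw [costFor_succ_det h.fits rfl]
      refine (add_le_add le_rfl (costFor_det_le h.fits rfl)).trans ?_
      have e1 : Op.add.eval (s'.reg (relocReg j a)) (s'.reg (relocReg j a)) = 2 * s.reg a := by
        rw [h.reg, Op.eval, two_mul]
      rw [e1]
      refine (add_le_add le_rfl (add_le_add le_rfl (costFor_det_le hr.fits rfl))).trans ?_
      refine (add_le_add le_rfl (add_le_add le_rfl (add_le_add le_rfl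
        (costFor_det_le hr.fits rfl)))).trans ?_
      have e2 : Op.add.eval ((s'.setReg 1 (2 * s.reg a)).reg 1)
          ((s'.setReg 1 (2 * s.reg a)).reg 2) = β + 2 * s.reg a := by
        rw [hr.base, Op.eval, add_comm]; simp [State.setReg]
      rw [e2, ← add_assoc, ← add_assoc, ← add_assoc]
      norm_num
    cases p with
    | skip => exact det rfl rfl fun _ => h
    | const d x => exact det rfl rfl fun hf => h.setReg d (hlt (fit_reg hf))
    | op o d a b =>
      refine det rfl rfl fun hf => ?_
      rw [h.reg, h.reg]
      exact h.setReg d (hlt (fit_reg hf))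
    | load d a =>
      have hr := (h.setAddr (x := 2 * s.reg a) (by have := addr a; omega)).setAddr (addr a)
      refine (fetch a _ _).trans ?_
      refine (add_le_add le_rfl (costFor_det_le hr.fits rfl)).trans ?_
      have e : ((s'.setReg 1 (2 * s.reg a)).setReg 1 (β + 2 * s.reg a)).mem
          (((s'.setReg 1 (2 * s.reg a)).setReg 1 (β + 2 * s.reg a)).reg 1) = s.mem (s.reg a) := by
        rw [← h.mem]; simp [State.setReg]
      rw [e, cost_det hs rfl, mul_add, add_assoc, ← add_assoc]
      refine add_le_add (by norm_num) (ih _ _ _ (hr.setReg d (hlt (hs _).2)))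
    | store a b =>
      have hr := (h.setAddr (x := 2 * s.reg a) (by have := addr a; omega)).setAddr (addr a)
      refine (fetch a _ _).trans ?_
      refine (add_le_add le_rfl (costFor_det_le hr.fits rfl)).trans ?_
      rw [hr.reg, cost_det hs rfl, mul_add, add_assoc, ← add_assoc]
      refine add_le_add (by norm_num) (ih _ _ _ ?_)
      have e : ((s'.setReg 1 (2 * s.reg a)).setReg 1 (β + 2 * s.reg a)).reg 1 =
          β + 2 * s.reg a := by simp [State.setReg]
      rw [e]
      exact hr.setMem _ (hlt (hs _).1)
    | rand d a =>
      rw [List.map_cons, List.cons_append, costFor, Prog.reloc, stepCost_running h.fits,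
        cost_running hs, mul_add, add_assoc]
      refine add_le_add (by norm_num) ?_
      rw [step_rand, step_rand, tsum_map_mul, tsum_map_mul, h.reg, ← ENNReal.tsum_mul_left]
      generalize uniformUpTo (s.reg a) = P
      calc ∑' x, P x * costFor B' y' N ⟨ks.map (Prog.reloc j) ++ k, s'.setReg (relocReg j d) x⟩
          ≤ ∑' x, (5 * (P x * cost B y ⟨ks, s.setReg d x⟩) + P x * K) := by
            refine ENNReal.tsum_le_tsum fun x => ?_
            have hx : costFor B' y' N ⟨ks.map (Prog.reloc j) ++ k, s'.setReg (relocReg j d) x⟩ ≤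
                5 * cost B y ⟨ks, s.setReg d x⟩ + K := by
              by_cases hf : (s.setReg d x).Fits B
              · exact ih _ _ _ (h.setReg d (hlt (fit_reg hf)))
              · rw [cost_of_not_fits hf, ENNReal.mul_top h5, top_add]; exact le_top
            calc _ ≤ P x * (5 * cost B y ⟨ks, s.setReg d x⟩ + K) := mul_le_mul_right hx _
              _ = _ := by ring
        _ = _ := by
            rw [ENNReal.tsum_add, ENNReal.tsum_mul_right, P.tsum_coe, one_mul]
    | seq p q => exact det (ks₁ := p :: q :: ks) rfl rfl fun _ => h
    | ite r p q =>
      refine det (ks₁ := (if s.reg r ≠ 0 then p else q) :: ks) rfl ?_ fun _ => h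
      simp only [List.map_cons, List.cons_append, Prog.reloc, step, h.reg]
      split_ifs <;> rfl
    | loop r p =>
      refine det (ks₁ := if s.reg r ≠ 0 then p :: .loop r p :: ks else ks) rfl ?_ fun _ => h
      simp only [List.map_cons, List.cons_append, Prog.reloc, step, h.reg]
      split_ifs <;> rfl

theorem cost_reloc_le {j β B B' y y' : ℕ} (hB : β + 2 * B ≤ B') {s₀ s s' : State} {p : Prog}
    {k : List Prog} {K : ℝ≥0∞}
    (hK : ∀ s s', Represents j β B' s₀ s s' → s.Fits B → s.reg 0 = y → cost B' y' ⟨k, s'⟩ ≤ K)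
    (h : Represents j β B' s₀ s s') :
    cost B' y' ⟨p.reloc j :: k, s'⟩ ≤ 5 * cost B y ⟨[p], s⟩ + K :=
  iSup_le fun N => costFor_reloc_le hB hK N [p] s s' h

end WordRAM

/-! ### Deterministic program pieces with step bounds -/

namespace WordRAM

theorem State.setReg_reg (s : State) (d x i : ℕ) :
    (s.setReg d x).reg i = if i = d then x else s.reg i := by
  simp [State.setReg, Function.update_apply]

theorem State.setReg_mem (s : State) (d x i : ℕ) : (s.setReg d x).mem i = s.mem i := rfl

/-- The program `p` takes the state `s` to the state `s'` in at most `t` steps, deterministically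
and within the word bound `B`. -/
def Exec (B : ℕ) (p : Prog) (t : ℕ) (s s' : State) : Prop :=
  s.Fits B → s'.Fits B ∧ ∀ y k, cost B y ⟨p :: k, s⟩ ≤ t + cost B y ⟨k, s'⟩

namespace Exec

variable {B : ℕ}

theorem of_step {p : Prog} {s s' : State} (hf : s.Fits B → s'.Fits B)
    (h : ∀ k, step ⟨p :: k, s⟩ = PMF.pure ⟨k, s'⟩) : Exec B p 1 s s' := fun hs =>
  ⟨hf hs, fun y k => by rw [cost_det hs (h k)]; simp⟩

theorem skip (s : State) : Exec B .skip 1 s s := of_step id fun _ => rfl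

theorem const (s : State) (d : ℕ) {x : ℕ} (hx : x < B) : Exec B (.const d x) 1 s (s.setReg d x) :=
  of_step (fun h => h.setReg hx) fun _ => rfl

theorem op (s : State) (o : Op) (d a b : ℕ) {x : ℕ} (hx : o.eval (s.reg a) (s.reg b) = x)
    (hB : x < B) : Exec B (.op o d a b) 1 s (s.setReg d x) :=
  of_step (fun h => h.setReg hB) fun _ => by subst hx; rfl

theorem load (s : State) (d a : ℕ) {x : ℕ} (hx : s.mem (s.reg a) = x) :
    Exec B (.load d a) 1 s (s.setReg d x) :=
  of_step (fun h => h.setReg (hx ▸ (h _).2)) fun _ => by subst hx; rfl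

theorem store (s : State) (a b : ℕ) {i x : ℕ} (hi : s.reg a = i) (hx : s.reg b = x) :
    Exec B (.store a b) 1 s (s.setMem i x) :=
  of_step (fun h => h.setMem (hx ▸ (h _).1)) fun _ => by subst hi hx; rfl

theorem seq {p q : Prog} {t u : ℕ} {s s₁ s₂ : State} (hp : Exec B p t s s₁)
    (hq : Exec B q u s₁ s₂) : Exec B (.seq p q) (1 + t + u) s s₂ := fun hs => by
  obtain ⟨h1, hp⟩ := hp hs
  obtain ⟨h2, hq⟩ := hq h1
  refine ⟨h2, fun y k => ?_⟩
  rw [cost_det (c' := ⟨p :: q :: k, s⟩) hs rfl]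
  push_cast
  rw [add_assoc, add_assoc]
  exact add_le_add le_rfl ((hp y _).trans (add_le_add le_rfl (hq y k)))

theorem mono {p : Prog} {t u : ℕ} {s s' : State} (h : Exec B p t s s') (htu : t ≤ u) :
    Exec B p u s s' := fun hs =>
  ⟨(h hs).1, fun y k => ((h hs).2 y k).trans (add_le_add (by exact_mod_cast htu) le_rfl)⟩

/-- `I i` holds before pass `i`, and exactly `N` passes are made. Each test of the register costs
one step, including the final failing one. -/
theorem loop {r t N : ℕ} {p : Prog} (I : ℕ → State → Prop)
    (hstep : ∀ i s, i < N → I i s → s.reg r ≠ 0 ∧ ∃ s', I (i + 1) s' ∧ Exec B p t s s')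
    (hend : ∀ s, I N s → s.reg r = 0) {s : State} (h0 : I 0 s) :
    ∃ s', I N s' ∧ Exec B (.loop r p) ((t + 1) * N + 1) s s' := by
  suffices H : ∀ M i s, i + M = N → I i s →
      ∃ s', I N s' ∧ Exec B (.loop r p) ((t + 1) * M + 1) s s' from H N 0 s (by simp) h0
  intro M
  induction M with
  | zero =>
    rintro i s hi hI
    obtain rfl : i = N := by simpa using hi
    exact ⟨s, hI, of_step id fun k => by simp [step, hend s hI]⟩
  | succ M ih =>
    intro i s hi hI
    obtain ⟨hr, s₁, hI₁, h₁⟩ := hstep i s (by omega) hI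
    obtain ⟨s₂, hI₂, h₂⟩ := ih (i + 1) s₁ (by omega) hI₁
    refine ⟨s₂, hI₂, fun hs => ?_⟩
    obtain ⟨hs₁, h₁⟩ := h₁ hs
    obtain ⟨hs₂, h₂⟩ := h₂ hs₁
    refine ⟨hs₂, fun y k => ?_⟩
    rw [cost_det (c' := ⟨p :: .loop r p :: k, s⟩) hs (by simp [step, hr])]
    calc (1 : ℝ≥0∞) + cost B y ⟨p :: .loop r p :: k, s⟩
        ≤ 1 + (t + (((t + 1) * M + 1 : ℕ) + cost B y ⟨k, s₂⟩)) := by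
          gcongr
          exact (h₁ y _).trans (add_le_add le_rfl (h₂ y k))
      _ = _ := by push_cast; ring

end Exec

/-! ### Writing lists of pairs -/

/-- The list `out` has been written to the cells `β + 2 * a`; apart from these and the registers
below `16`, the state is that of `s₀`. -/
structure Writing (β B m : ℕ) (s₀ : State) (out : List ℕ) (s : State) : Prop where
  fits : s.Fits B
  base : s.reg 2 = β
  ptr : s.reg 3 = β + 2 * out.length
  one : s.reg 4 = 1
  two : s.reg 5 = 2
  width : s.reg 6 = m
  cells : ∀ a, s.mem (β + 2 * a) = out.getD a 0
  otherMem : ∀ x, (∀ a, x ≠ β + 2 * a) → s.mem x = s₀.mem x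
  otherReg : ∀ i, 16 ≤ i → s.reg i = s₀.reg i

/-- Append the number `reg r + a` to the list that is being written. -/
def emit (r a : ℕ) : Prog :=
  .seq (.const 10 a) (.seq (.op .add 10 r 10) (.seq (.store 3 10) (.op .add 3 3 5)))

/-- Append the numbers `reg 11 + a` and `reg 12 + b` for all `(a, b)` in the list. -/
def emitPairs : List (ℕ × ℕ) → Prog
  | [] => .skip
  | ab :: l => .seq (emit 11 ab.1) (.seq (emit 12 ab.2) (emitPairs l))

theorem Writing.setReg {β B m : ℕ} {s₀ s : State} {out : List ℕ} (h : Writing β B m s₀ out s)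
    {d x : ℕ} (h1 : 7 ≤ d) (h2 : d < 16) (hx : x < B) :
    Writing β B m s₀ out (s.setReg d x) where
  fits := h.fits.setReg hx
  base := by rw [State.setReg_reg, if_neg (by omega), h.base]
  ptr := by rw [State.setReg_reg, if_neg (by omega), h.ptr]
  one := by rw [State.setReg_reg, if_neg (by omega), h.one]
  two := by rw [State.setReg_reg, if_neg (by omega), h.two]
  width := by rw [State.setReg_reg, if_neg (by omega), h.width]
  cells := h.cells
  otherMem := h.otherMem
  otherReg i hi := by rw [State.setReg_reg, if_neg (by omega), h.otherReg i hi]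

/-- The bound 7 counts four instructions and three `seq`. Register 10 is scratch space, hence `r ≠
10`. -/
theorem exec_emit {β B m r a : ℕ} {s₀ s : State} {out : List ℕ} (h : Writing β B m s₀ out s)
    (hr : r ≠ 10) (ha : a < B) (hx : s.reg r + a < B) (hout : β + 2 * (out.length + 1) < B) :
    ∃ s', Writing β B m s₀ (out ++ [s.reg r + a]) s' ∧
      (∀ i, i ≠ 3 → i ≠ 10 → s'.reg i = s.reg i) ∧ Exec B (emit r a) 7 s s' := by
  let s₁ := (s.setReg 10 a).setReg 10 (s.reg r + a)
  let s₂ := s₁.setMem (β + 2 * out.length) (s.reg r + a)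
  have h₁ : Writing β B m s₀ out s₁ :=
    (h.setReg (by norm_num) (by norm_num) ha).setReg (by norm_num) (by norm_num) hx
  have e₁ : ∀ i, i ≠ 10 → s₁.reg i = s.reg i := fun i hi => by
    simp [s₁, State.setReg_reg, hi]
  refine ⟨s₂.setReg 3 (β + 2 * (out.length + 1)), ?_, ?_, ?_⟩
  · have e₂ : ∀ i, i ≠ 3 → (s₂.setReg 3 (β + 2 * (out.length + 1))).reg i = s₁.reg i :=
      fun i hi => by rw [State.setReg_reg, if_neg hi]; rfl
    refine ⟨(h₁.fits.setMem hx).setReg hout, ?_, ?_, ?_, ?_, ?_, ?_, ?_, ?_⟩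
    · rw [e₂ _ (by norm_num), h₁.base]
    · simp [State.setReg_reg]
    · rw [e₂ _ (by norm_num), h₁.one]
    · rw [e₂ _ (by norm_num), h₁.two]
    · rw [e₂ _ (by norm_num), h₁.width]
    · intro b
      rw [State.setReg_mem]
      by_cases hb : b = out.length
      · subst hb; simp [s₂, State.setMem]
      · have : β + 2 * b ≠ β + 2 * out.length := by omega
        simp only [s₂, State.setMem, ne_eq, this, not_false_eq_true, Function.update_of_ne,
          h₁.cells]
        rcases Nat.lt_or_gt_of_ne hb with hb | hb
        · rw [List.getD_append _ _ _ _ hb]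
        · rw [List.getD_eq_default _ _ hb.le, List.getD_eq_default _ _ (by simpa using hb)]
    · intro x hx
      rw [State.setReg_mem]
      simp only [s₂, State.setMem, ne_eq, hx out.length, not_false_eq_true, Function.update_of_ne,
        h₁.otherMem x hx]
    · intro i hi
      rw [e₂ _ (by omega), h₁.otherReg i hi]
  · intro i h3 h10
    rw [State.setReg_reg, if_neg h3, ← e₁ i h10]
    rfl
  · refine (Exec.const s 10 ha).seq ((Exec.op _ .add 10 r 10 (x := s.reg r + a) ?_ hx).seq
      ((Exec.store s₁ 3 10 h₁.ptr ?_).seq (Exec.op s₂ .add 3 3 5 ?_ hout)))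
    · simp [State.setReg_reg, Op.eval, hr]
    · simp [s₁, State.setReg_reg]
    · change s₁.reg 3 + s₁.reg 5 = _
      rw [h₁.ptr, h₁.two]; ring

theorem length_flatMap_pair {α : Type*} (l : List α) (f g : α → ℕ) :
    (l.flatMap fun x => [f x, g x]).length = 2 * l.length := by
  induction l with
  | nil => rfl
  | cons x l ih => simp only [List.flatMap_cons, List.length_append, ih]; simp; ring

/-- Each pair costs two calls of `emit` and two `seq`, that is 16 steps; the final `skip` costs one
more. -/
theorem exec_emitPairs {β B m u v M : ℕ} {s₀ : State} (l : List (ℕ × ℕ))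
    (hM : M < B) (hl : ∀ ab ∈ l, u + ab.1 ≤ M ∧ v + ab.2 ≤ M) :
    ∀ {s : State} {out : List ℕ}, Writing β B m s₀ out s → s.reg 11 = u → s.reg 12 = v →
      β + 2 * (out.length + 2 * l.length) < B →
      ∃ s', Writing β B m s₀ (out ++ l.flatMap fun ab => [u + ab.1, v + ab.2]) s' ∧
        (∀ i, i ≠ 3 → i ≠ 10 → s'.reg i = s.reg i) ∧
        Exec B (emitPairs l) (16 * l.length + 1) s s' := by
  induction l with
  | nil => intro s out h _ _ _; exact ⟨s, by simpa using h, fun _ _ _ => rfl, Exec.skip s⟩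
  | cons ab l ih =>
    intro s out h hu hv hout
    obtain ⟨ha, hb⟩ := hl ab (by simp)
    simp only [List.length_cons] at hout
    obtain ⟨s₁, h₁, e₁, x₁⟩ := exec_emit (r := 11) (a := ab.1) h (by norm_num) (by omega)
      (by omega) (by omega)
    have hv₁ : s₁.reg 12 = v := by rw [e₁ _ (by norm_num) (by norm_num), hv]
    obtain ⟨s₂, h₂, e₂, x₂⟩ := exec_emit (r := 12) (a := ab.2) h₁ (by norm_num) (by omega)
      (by omega) (by simp only [List.length_append, List.length_singleton]; omega)
    obtain ⟨s₃, h₃, e₃, x₃⟩ := ih (fun x hx => hl x (by simp [hx])) h₂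
      (by rw [e₂ _ (by norm_num) (by norm_num), e₁ _ (by norm_num) (by norm_num), hu])
      (by rw [e₂ _ (by norm_num) (by norm_num), hv₁])
      (by simp only [List.length_append, List.length_singleton]; omega)
    refine ⟨s₃, ?_, fun i h3 h10 => by rw [e₃ i h3 h10, e₂ i h3 h10, e₁ i h3 h10],
      (x₁.seq (x₂.seq x₃)).mono (by simp only [List.length_cons]; omega)⟩
    simpa [hu, hv₁] using h₃

end WordRAM

/-! ### A linear-time program that writes a product graph -/

namespace WordRAM

/-- For every pair `(u, v)` in memory from address `reg 13` on, and every `(a, b)` in `l`, append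
`m * u + a` and `m * v + b`, where `m` is in register `6`; the number of pairs is in register `7`. -/
def edgeLoop (l : List (ℕ × ℕ)) : Prog :=
  .loop 7 (.seq (.load 11 13) (.seq (.op .add 13 13 4) (.seq (.load 12 13) (.seq (.op .add 13 13 4)
    (.seq (.op .mul 11 11 6) (.seq (.op .mul 12 12 6)
      (.seq (emitPairs l) (.op .sub 7 7 4))))))))

/-- For every `u` from `reg 13` on and every `(a, b)` in `l`, append `m * u + a` and `m * u + b`,
where `m` is in register `6`; the number of values of `u` is in register `9`. -/
def vertexLoop (l : List (ℕ × ℕ)) : Prog :=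
  .loop 9 (.seq (.op .mul 11 13 6) (.seq (.op .mul 12 13 6)
    (.seq (emitPairs l) (.seq (.op .add 13 13 4) (.op .sub 9 9 4)))))

/-- The entries written for the edges `E`. -/
def edgeOutput (m : ℕ) (l E : List (ℕ × ℕ)) : List ℕ :=
  E.flatMap fun e => l.flatMap fun ab => [e.1 * m + ab.1, e.2 * m + ab.2]

/-- The entries written for the vertices below `n`. -/
def vertexOutput (m : ℕ) (l : List (ℕ × ℕ)) (n : ℕ) : List ℕ :=
  (List.range n).flatMap fun u => l.flatMap fun ab => [u * m + ab.1, u * m + ab.2]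

theorem length_edgeOutput (m : ℕ) (l E : List (ℕ × ℕ)) :
    (edgeOutput m l E).length = 2 * (E.length * l.length) := by
  induction E with
  | nil => simp [edgeOutput]
  | cons e E ih =>
    simp only [edgeOutput] at ih
    simp only [edgeOutput, List.flatMap_cons, List.length_append, ih, length_flatMap_pair,
      List.length_cons]
    ring

theorem length_vertexOutput (m : ℕ) (l : List (ℕ × ℕ)) (n : ℕ) :
    (vertexOutput m l n).length = 2 * (n * l.length) := by
  induction n with
  | zero => simp [vertexOutput]
  | succ n ih =>
    simp only [vertexOutput] at ih
    simp only [vertexOutput, List.range_succ, List.flatMap_append, List.length_append, ih,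
      List.flatMap_cons, List.flatMap_nil, length_flatMap_pair, List.append_nil]
    ring

theorem edgeOutput_take_succ (m : ℕ) (l E : List (ℕ × ℕ)) (i : ℕ) (hi : i < E.length) :
    edgeOutput m l (E.take (i + 1)) = edgeOutput m l (E.take i) ++
      l.flatMap fun ab => [E[i].1 * m + ab.1, E[i].2 * m + ab.2] := by
  rw [List.take_succ_eq_append_getElem hi, edgeOutput, List.flatMap_append, List.flatMap_singleton,
    edgeOutput]

/-- The output starts at `β`, behind the input by `hβ`, so the edges are read as they were in `s₀`.
Register 9 is tracked because the vertex loop needs it afterwards. -/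
theorem exec_edgeLoop {β B m n : ℕ} {s₀ : State} (l E : List (ℕ × ℕ))
    (hl : ∀ ab ∈ l, ab.1 < m ∧ ab.2 < m) (hE : ∀ e ∈ E, e.1 < n ∧ e.2 < n)
    (hβ : 2 + 2 * E.length ≤ β) (hnm : n * m < B)
    (hin : ∀ i (hi : i < E.length), s₀.mem (2 + 2 * i) = E[i].1 ∧ s₀.mem (3 + 2 * i) = E[i].2)
    {s : State} {out : List ℕ} (h : Writing β B m s₀ out s)
    (h7 : s.reg 7 = E.length) (h13 : s.reg 13 = 2)
    (hout : β + 2 * (out.length + 2 * (E.length * l.length)) < B) :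
    ∃ s', Writing β B m s₀ (out ++ edgeOutput m l E) s' ∧ s'.reg 9 = s.reg 9 ∧
      Exec B (edgeLoop l) ((16 * l.length + 16) * E.length + 1) s s' := by
  have key := Exec.loop (B := B) (r := 7) (N := E.length) (t := 16 * l.length + 15)
    (p := .seq (.load 11 13) (.seq (.op .add 13 13 4) (.seq (.load 12 13)
      (.seq (.op .add 13 13 4) (.seq (.op .mul 11 11 6) (.seq (.op .mul 12 12 6)
        (.seq (emitPairs l) (.op .sub 7 7 4))))))))
    (fun i t => Writing β B m s₀ (out ++ edgeOutput m l (E.take i)) t ∧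
      t.reg 7 = E.length - i ∧ t.reg 13 = 2 + 2 * i ∧ t.reg 9 = s.reg 9) ?_ ?_ (s := s) ?_
  · obtain ⟨s', ⟨h', -, -, e9⟩, hx⟩ := key
    rw [List.take_length] at h'
    exact ⟨s', h', e9, hx⟩
  · rintro i t hi ⟨ht, t7, t13, t9⟩
    refine ⟨by omega, ?_⟩
    have hEi := hE _ (List.getElem_mem hi)
    have hmem : t.mem (2 + 2 * i) = E[i].1 ∧ t.mem (3 + 2 * i) = E[i].2 := by
      -- Both addresses lie below `β`, outside the cells being written.
      rw [ht.otherMem _ (fun a => by omega), ht.otherMem _ (fun a => by omega)]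
      exact hin i hi
    have hu : E[i].1 * m + m ≤ n * m := by
      calc E[i].1 * m + m = (E[i].1 + 1) * m := by ring
        _ ≤ n * m := Nat.mul_le_mul_right _ hEi.1
    have hv : E[i].2 * m + m ≤ n * m := by
      calc E[i].2 * m + m = (E[i].2 + 1) * m := by ring
        _ ≤ n * m := Nat.mul_le_mul_right _ hEi.2
    have hu' : E[i].1 < B := hmem.1 ▸ (ht.fits _).2
    have hv' : E[i].2 < B := hmem.2 ▸ (ht.fits _).2
    have b1 : 2 + 2 * i + 1 < B := by omega
    have b2 : 2 + 2 * i + 1 + 1 < B := by omega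
    set t₁ := t.setReg 11 E[i].1 with ht₁
    set t₂ := t₁.setReg 13 (2 + 2 * i + 1) with ht₂
    set t₃ := t₂.setReg 12 E[i].2 with ht₃
    set t₄ := t₃.setReg 13 (2 + 2 * i + 1 + 1) with ht₄
    set t₅ := t₄.setReg 11 (E[i].1 * m) with ht₅
    set t₆ := t₅.setReg 12 (E[i].2 * m) with ht₆
    have w₁ : Writing β B m s₀ _ t₁ := ht.setReg (by norm_num) (by norm_num) hu'
    have w₂ : Writing β B m s₀ _ t₂ := w₁.setReg (by norm_num) (by norm_num) b1
    have w₃ : Writing β B m s₀ _ t₃ := w₂.setReg (by norm_num) (by norm_num) hv'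
    have w₄ : Writing β B m s₀ _ t₄ := w₃.setReg (by norm_num) (by norm_num) b2
    have w₅ : Writing β B m s₀ _ t₅ := w₄.setReg (by norm_num) (by norm_num) (by omega)
    have w₆ : Writing β B m s₀ _ t₆ := w₅.setReg (by norm_num) (by norm_num) (by omega)
    have hlen : (out ++ edgeOutput m l (E.take i)).length = out.length + 2 * (i * l.length) := by
      rw [List.length_append, length_edgeOutput, List.length_take, min_eq_left hi.le]
    have hil : i * l.length + l.length ≤ E.length * l.length := by
      calc i * l.length + l.length = (i + 1) * l.length := by ring
        _ ≤ _ := Nat.mul_le_mul_right _ hi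
    obtain ⟨t₇, w₇, e₇, x₇⟩ := exec_emitPairs (u := E[i].1 * m) (v := E[i].2 * m) l hnm
      (fun ab hab => by have := hl ab hab; omega) w₆
      (by simp [ht₆, ht₅, State.setReg_reg]) (by simp [ht₆, State.setReg_reg])
      (by rw [hlen]; omega)
    have r₇ : t₇.reg 7 = E.length - i := by
      rw [e₇ _ (by norm_num) (by norm_num)]
      simp [ht₆, ht₅, ht₄, ht₃, ht₂, ht₁, State.setReg_reg, t7]
    refine ⟨t₇.setReg 7 (E.length - (i + 1)), ⟨?_, ?_, ?_, ?_⟩, ?_⟩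
    · rw [edgeOutput_take_succ m l E i hi, ← List.append_assoc]
      exact w₇.setReg (by norm_num) (by norm_num) (by omega)
    · simp [State.setReg_reg]
    · rw [State.setReg_reg, if_neg (by norm_num), e₇ _ (by norm_num) (by norm_num)]
      simp [ht₆, ht₅, ht₄, State.setReg_reg]; ring
    · rw [State.setReg_reg, if_neg (by norm_num), e₇ _ (by norm_num) (by norm_num)]
      simp [ht₆, ht₅, ht₄, ht₃, ht₂, ht₁, State.setReg_reg, t9]
    · have q₁ : Exec B (.load 11 13) 1 t t₁ := Exec.load t 11 13 (by rw [t13, hmem.1])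
      have q₂ : Exec B (.op .add 13 13 4) 1 t₁ t₂ :=
        Exec.op t₁ .add 13 13 4 (by rw [w₁.one]; simp [ht₁, State.setReg_reg, t13, Op.eval]) b1
      have q₃ : Exec B (.load 12 13) 1 t₂ t₃ := Exec.load t₂ 12 13 (by
        rw [← hmem.2]; simp only [ht₂, ht₁, State.setReg_reg, State.setReg_mem, if_true]
        congr 1; omega)
      have q₄ : Exec B (.op .add 13 13 4) 1 t₃ t₄ :=
        Exec.op t₃ .add 13 13 4 (by rw [w₃.one]; simp [ht₃, ht₂, State.setReg_reg, Op.eval]) b2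
      have q₅ : Exec B (.op .mul 11 11 6) 1 t₄ t₅ :=
        Exec.op t₄ .mul 11 11 6 (by
          rw [w₄.width]; simp [ht₄, ht₃, ht₂, ht₁, State.setReg_reg, Op.eval]) (by omega)
      have q₆ : Exec B (.op .mul 12 12 6) 1 t₅ t₆ :=
        Exec.op t₅ .mul 12 12 6 (by
          rw [w₅.width]; simp [ht₅, ht₄, ht₃, State.setReg_reg, Op.eval]) (by omega)
      have q₈ : Exec B (.op .sub 7 7 4) 1 t₇ (t₇.setReg 7 (E.length - (i + 1))) :=
        Exec.op t₇ .sub 7 7 4 (by rw [w₇.one, r₇, Op.eval]; omega) (by omega)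
      exact (q₁.seq (q₂.seq (q₃.seq (q₄.seq (q₅.seq (q₆.seq (x₇.seq q₈))))))).mono (by omega)
  · rintro t ⟨-, t7, -, -⟩
    omega
  · refine ⟨by simpa [edgeOutput] using h, by simpa using h7, by simpa using h13, rfl⟩

theorem exec_vertexLoop {β B m n : ℕ} {s₀ : State} (l : List (ℕ × ℕ))
    (hl : ∀ ab ∈ l, ab.1 < m ∧ ab.2 < m) (hn : n < B) (hnm : n * m < B)
    {s : State} {out : List ℕ} (h : Writing β B m s₀ out s)
    (h9 : s.reg 9 = n) (h13 : s.reg 13 = 0)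
    (hout : β + 2 * (out.length + 2 * (n * l.length)) < B) :
    ∃ s', Writing β B m s₀ (out ++ vertexOutput m l n) s' ∧
      Exec B (vertexLoop l) ((16 * l.length + 16) * n + 1) s s' := by
  have key := Exec.loop (B := B) (r := 9) (N := n) (t := 16 * l.length + 15)
    (p := .seq (.op .mul 11 13 6) (.seq (.op .mul 12 13 6)
      (.seq (emitPairs l) (.seq (.op .add 13 13 4) (.op .sub 9 9 4)))))
    (fun i t => Writing β B m s₀ (out ++ vertexOutput m l i) t ∧
      t.reg 9 = n - i ∧ t.reg 13 = i) ?_ ?_ (s := s) ?_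
  · obtain ⟨s', ⟨h', -, -⟩, hx⟩ := key
    exact ⟨s', h', hx⟩
  · rintro i t hi ⟨ht, t9, t13⟩
    refine ⟨by omega, ?_⟩
    have hu : i * m + m ≤ n * m := by
      calc i * m + m = (i + 1) * m := by ring
        _ ≤ n * m := Nat.mul_le_mul_right _ hi
    set t₁ := t.setReg 11 (i * m) with ht₁
    set t₂ := t₁.setReg 12 (i * m) with ht₂
    have w₁ : Writing β B m s₀ _ t₁ := ht.setReg (by norm_num) (by norm_num) (by omega)
    have w₂ : Writing β B m s₀ _ t₂ := w₁.setReg (by norm_num) (by norm_num) (by omega)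
    have hlen : (out ++ vertexOutput m l i).length = out.length + 2 * (i * l.length) := by
      rw [List.length_append, length_vertexOutput]
    have hil : i * l.length + l.length ≤ n * l.length := by
      calc i * l.length + l.length = (i + 1) * l.length := by ring
        _ ≤ _ := Nat.mul_le_mul_right _ hi
    obtain ⟨t₃, w₃, e₃, x₃⟩ := exec_emitPairs (u := i * m) (v := i * m) l hnm
      (fun ab hab => by have := hl ab hab; omega) w₂
      (by simp [ht₂, ht₁, State.setReg_reg]) (by simp [ht₂, State.setReg_reg])
      (by rw [hlen]; omega)
    have r₁₃ : t₃.reg 13 = i := by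
      rw [e₃ _ (by norm_num) (by norm_num)]
      simp [ht₂, ht₁, State.setReg_reg, t13]
    have r₉ : t₃.reg 9 = n - i := by
      rw [e₃ _ (by norm_num) (by norm_num)]
      simp [ht₂, ht₁, State.setReg_reg, t9]
    set t₄ := t₃.setReg 13 (i + 1) with ht₄
    have w₄ : Writing β B m s₀ _ t₄ := w₃.setReg (by norm_num) (by norm_num) (by omega)
    refine ⟨t₄.setReg 9 (n - (i + 1)), ⟨?_, ?_, ?_⟩, ?_⟩
    · have : vertexOutput m l (i + 1) = vertexOutput m l i ++
          l.flatMap fun ab => [i * m + ab.1, i * m + ab.2] := by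
        simp [vertexOutput, List.range_succ]
      rw [this, ← List.append_assoc]
      exact w₄.setReg (by norm_num) (by norm_num) (by omega)
    · simp [State.setReg_reg]
    · simp [ht₄, State.setReg_reg]
    · have q₁ : Exec B (.op .mul 11 13 6) 1 t t₁ :=
        Exec.op t .mul 11 13 6 (by rw [ht.width, t13, Op.eval]) (by omega)
      have q₂ : Exec B (.op .mul 12 13 6) 1 t₁ t₂ :=
        Exec.op t₁ .mul 12 13 6 (by
          rw [w₁.width]; simp [ht₁, State.setReg_reg, t13, Op.eval]) (by omega)
      have q₄ : Exec B (.op .add 13 13 4) 1 t₃ t₄ :=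
        Exec.op t₃ .add 13 13 4 (by rw [w₃.one, r₁₃, Op.eval]) (by omega)
      have q₅ : Exec B (.op .sub 9 9 4) 1 t₄ (t₄.setReg 9 (n - (i + 1))) :=
        Exec.op t₄ .sub 9 9 4 (by
          rw [w₄.one]; simp only [ht₄, State.setReg_reg, Op.eval]; norm_num [r₉]; omega) (by omega)
      exact (q₁.seq (q₂.seq (x₃.seq (q₄.seq q₅)))).mono (by omega)
  · rintro t ⟨-, t9, -⟩
    omega
  · exact ⟨by simpa [vertexOutput] using h, by simpa using h9, h13⟩

/-- Set up the registers for writing to the cells `β + 2 * a`, where `β = 2 * mem 1 + 2 + j`. -/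
def prepare (j m : ℕ) : Prog :=
  .seq (.const 4 1) (.seq (.const 5 2) (.seq (.const 6 m) (.seq (.const 8 0) (.seq (.load 7 4)
    (.seq (.load 9 8) (.seq (.op .add 2 7 7) (.seq (.op .add 2 2 5) (.seq (.const 10 j)
      (.seq (.op .add 2 2 10) (.op .add 3 2 8))))))))))

theorem exec_prepare {B j m n e β : ℕ} {s : State} (hs : s.Fits B) (h0 : s.mem 0 = n)
    (h1 : s.mem 1 = e) (hm : m < B) (hβ : β = 2 * e + 2 + j) (hB : β + 2 < B)
    (hz : ∀ a, s.mem (β + 2 * a) = 0) :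
    ∃ s', Writing β B m s [] s' ∧ s'.reg 7 = e ∧ s'.reg 9 = n ∧ Exec B (prepare j m) 21 s s' := by
  have q₁ : Exec B (.const 4 1) 1 s _ := Exec.const s 4 (x := 1) (by omega)
  have q₂ : Exec B (.const 5 2) 1 _ _ := Exec.const (s.setReg 4 1) 5 (x := 2) (by omega)
  have q₃ : Exec B (.const 6 m) 1 _ _ := Exec.const ((s.setReg 4 1).setReg 5 2) 6 hm
  have q₄ : Exec B (.const 8 0) 1 _ _ :=
    Exec.const (((s.setReg 4 1).setReg 5 2).setReg 6 m) 8 (x := 0) (by omega)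
  set s₄ := (((s.setReg 4 1).setReg 5 2).setReg 6 m).setReg 8 0 with hs₄
  have q₅ : Exec B (.load 7 4) 1 s₄ (s₄.setReg 7 e) := Exec.load s₄ 7 4 (by
    simp [hs₄, State.setReg_reg, State.setReg_mem, h1])
  have q₆ : Exec B (.load 9 8) 1 (s₄.setReg 7 e) ((s₄.setReg 7 e).setReg 9 n) :=
    Exec.load _ 9 8 (by simp [hs₄, State.setReg_reg, State.setReg_mem, h0])
  set s₆ := (s₄.setReg 7 e).setReg 9 n with hs₆
  have q₇ : Exec B (.op .add 2 7 7) 1 s₆ (s₆.setReg 2 (e + e)) :=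
    Exec.op s₆ .add 2 7 7 (by simp [hs₆, State.setReg_reg, Op.eval]) (by omega)
  have q₈ : Exec B (.op .add 2 2 5) 1 (s₆.setReg 2 (e + e))
      ((s₆.setReg 2 (e + e)).setReg 2 (e + e + 2)) :=
    Exec.op _ .add 2 2 5 (by simp [hs₆, hs₄, State.setReg_reg, Op.eval]) (by omega)
  set s₈ := (s₆.setReg 2 (e + e)).setReg 2 (e + e + 2) with hs₈
  have q₉ : Exec B (.const 10 j) 1 s₈ (s₈.setReg 10 j) := Exec.const s₈ 10 (by omega)
  have q₁₀ : Exec B (.op .add 2 2 10) 1 (s₈.setReg 10 j) ((s₈.setReg 10 j).setReg 2 β) :=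
    Exec.op _ .add 2 2 10 (by simp [hs₈, State.setReg_reg, Op.eval]; omega) (by omega)
  set s₁₀ := (s₈.setReg 10 j).setReg 2 β with hs₁₀
  have q₁₁ : Exec B (.op .add 3 2 8) 1 s₁₀ (s₁₀.setReg 3 β) :=
    Exec.op _ .add 3 2 8
      (by simp [hs₁₀, hs₈, hs₆, hs₄, State.setReg_reg, Op.eval]) (by omega)
  have q := q₁.seq (q₂.seq (q₃.seq (q₄.seq (q₅.seq (q₆.seq (q₇.seq (q₈.seq (q₉.seq
    (q₁₀.seq q₁₁)))))))))
  refine ⟨s₁₀.setReg 3 β, ⟨(q hs).1, ?_, ?_, ?_, ?_, ?_, ?_, ?_, ?_⟩, ?_, ?_, q⟩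
  · simp [hs₁₀, State.setReg_reg]
  · simp [State.setReg_reg]
  · simp [hs₁₀, hs₈, hs₆, hs₄, State.setReg_reg]
  · simp [hs₁₀, hs₈, hs₆, hs₄, State.setReg_reg]
  · simp [hs₁₀, hs₈, hs₆, hs₄, State.setReg_reg]
  · intro a; simpa [hs₁₀, hs₈, hs₆, hs₄, State.setReg_mem] using hz a
  · intro x _; rfl
  · intro i hi
    simp only [hs₁₀, hs₈, hs₆, hs₄, State.setReg_reg]
    repeat rw [if_neg (by omega)]
  · simp [hs₁₀, hs₈, hs₆, hs₄, State.setReg_reg]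
  · simp [hs₁₀, hs₈, hs₆, hs₄, State.setReg_reg]

/-- Write the encoding of a product of the input graph with a fixed graph on `m` vertices. -/
def writeProduct (j m : ℕ) (A D : List (ℕ × ℕ)) : Prog :=
  .seq (prepare j m) (.seq (.op .mul 11 9 6) (.seq (emit 11 0) (.seq (.const 10 A.length)
    (.seq (.op .mul 11 7 10) (.seq (.const 10 D.length) (.seq (.op .mul 12 9 10)
      (.seq (.op .add 11 11 12) (.seq (emit 11 0) (.seq (.const 13 2) (.seq (edgeLoop A)
        (.seq (.const 13 0) (vertexLoop D))))))))))))

/-- The list written by `writeProduct`. -/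
def productOutput (m n : ℕ) (A D E : List (ℕ × ℕ)) : List ℕ :=
  n * m :: (E.length * A.length + n * D.length) :: (edgeOutput m A E ++ vertexOutput m D n)

theorem exec_writeProduct {B j m n β : ℕ} {s : State} (A D E : List (ℕ × ℕ))
    (hA : ∀ ab ∈ A, ab.1 < m ∧ ab.2 < m) (hD : ∀ ab ∈ D, ab.1 < m ∧ ab.2 < m)
    (hE : ∀ e ∈ E, e.1 < n ∧ e.2 < n) (hs : s.Fits B) (h0 : s.mem 0 = n)
    (h1 : s.mem 1 = E.length)
    (hin : ∀ i (hi : i < E.length), s.mem (2 + 2 * i) = E[i].1 ∧ s.mem (3 + 2 * i) = E[i].2)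
    (hβ : β = 2 * E.length + 2 + j) (hz : ∀ a, s.mem (β + 2 * a) = 0)
    (hB : β + 4 * (E.length * A.length + n * D.length) + 4 + n * m + m + A.length + D.length < B) :
    ∃ s', Writing β B m s (productOutput m n A D E) s' ∧
      Exec B (writeProduct j m A D)
        ((16 * A.length + 16) * E.length + (16 * D.length + 16) * n + 100) s s' := by
  have hn : n < B := h0 ▸ (hs 0).2
  obtain ⟨s₁, w₁, r₇, r₉, x₁⟩ := exec_prepare (m := m) hs h0 h1 (by omega) hβ (by omega) hz
  set s₂ := s₁.setReg 11 (n * m) with hs₂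
  have w₂ : Writing β B m s [] s₂ := w₁.setReg (by norm_num) (by norm_num) (by omega)
  have q₂ : Exec B (.op .mul 11 9 6) 1 s₁ s₂ :=
    Exec.op s₁ .mul 11 9 6 (by rw [w₁.width, r₉, Op.eval]) (by omega)
  have v₂ : s₂.reg 11 = n * m := by simp [hs₂, State.setReg_reg]
  obtain ⟨s₃, w₃, e₃, x₃⟩ := exec_emit (r := 11) (a := 0) w₂ (by norm_num) (by omega)
    (by omega) (by simp; omega)
  have c₇ : s₃.reg 7 = E.length := by
    rw [e₃ _ (by norm_num) (by norm_num)]; simp [hs₂, State.setReg_reg, r₇]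
  have c₉ : s₃.reg 9 = n := by
    rw [e₃ _ (by norm_num) (by norm_num)]; simp [hs₂, State.setReg_reg, r₉]
  set s₄ := s₃.setReg 10 A.length with hs₄
  set s₅ := s₄.setReg 11 (E.length * A.length) with hs₅
  set s₆ := s₅.setReg 10 D.length with hs₆
  set s₇ := s₆.setReg 12 (n * D.length) with hs₇
  set s₈ := s₇.setReg 11 (E.length * A.length + n * D.length) with hs₈
  have w₈ : Writing β B m s _ s₈ :=
    ((((w₃.setReg (d := 10) (x := A.length) (by norm_num) (by norm_num) (by omega)).setReg
      (d := 11) (x := E.length * A.length) (by norm_num) (by norm_num) (by omega)).setReg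
      (d := 10) (x := D.length) (by norm_num) (by norm_num) (by omega)).setReg
      (d := 12) (x := n * D.length) (by norm_num) (by norm_num) (by omega)).setReg
      (d := 11) (x := E.length * A.length + n * D.length) (by norm_num) (by norm_num) (by omega)
  have q₄ : Exec B (.const 10 A.length) 1 s₃ s₄ := Exec.const s₃ 10 (by omega)
  have q₅ : Exec B (.op .mul 11 7 10) 1 s₄ s₅ :=
    Exec.op s₄ .mul 11 7 10 (by simp [hs₄, State.setReg_reg, c₇, Op.eval]) (by omega)
  have q₆ : Exec B (.const 10 D.length) 1 s₅ s₆ := Exec.const s₅ 10 (by omega)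
  have q₇ : Exec B (.op .mul 12 9 10) 1 s₆ s₇ :=
    Exec.op s₆ .mul 12 9 10 (by simp [hs₆, hs₅, hs₄, State.setReg_reg, c₉, Op.eval]) (by omega)
  have q₈ : Exec B (.op .add 11 11 12) 1 s₇ s₈ :=
    Exec.op s₇ .add 11 11 12 (by simp [hs₇, hs₆, hs₅, State.setReg_reg, Op.eval]) (by omega)
  have v₈ : s₈.reg 11 = E.length * A.length + n * D.length := by simp [hs₈, State.setReg_reg]
  obtain ⟨s₉, w₉, e₉, x₉⟩ := exec_emit (r := 11) (a := 0) w₈ (by norm_num) (by omega)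
    (by omega) (by simp; omega)
  have w₁₀ := w₉.setReg (d := 13) (x := 2) (by norm_num) (by norm_num) (by omega)
  have q₁₀ : Exec B (.const 13 2) 1 s₉ (s₉.setReg 13 2) := Exec.const s₉ 13 (by omega)
  obtain ⟨s₁₁, w₁₁, f₁₁, x₁₁⟩ := exec_edgeLoop A E hA hE (by omega) (by omega) hin w₁₀
    (by rw [State.setReg_reg, if_neg (by norm_num), e₉ _ (by norm_num) (by norm_num)]
        simp [hs₈, hs₇, hs₆, hs₅, hs₄, State.setReg_reg, c₇])
    (by simp [State.setReg_reg]) (by simp; omega)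
  have w₁₂ := w₁₁.setReg (d := 13) (x := 0) (by norm_num) (by norm_num) (by omega)
  have q₁₂ : Exec B (.const 13 0) 1 s₁₁ (s₁₁.setReg 13 0) := Exec.const s₁₁ 13 (by omega)
  obtain ⟨s₁₃, w₁₃, x₁₃⟩ := exec_vertexLoop (n := n) D hD hn (by omega) w₁₂
    (by rw [State.setReg_reg, if_neg (by norm_num), f₁₁, State.setReg_reg, if_neg (by norm_num),
          e₉ _ (by norm_num) (by norm_num)]
        simp [hs₈, hs₇, hs₆, hs₅, hs₄, State.setReg_reg, c₉])
    (by simp [State.setReg_reg])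
    (by simp only [List.length_append, length_edgeOutput, List.length_singleton, List.length_nil]
        omega)
  refine ⟨s₁₃, ?_, (x₁.seq (q₂.seq (x₃.seq (q₄.seq (q₅.seq (q₆.seq (q₇.seq (q₈.seq (x₉.seq
    (q₁₀.seq (x₁₁.seq (q₁₂.seq x₁₃)))))))))))).mono (by omega)⟩
  have e : productOutput m n A D E = [] ++ [s₂.reg 11 + 0] ++ [s₈.reg 11 + 0] ++
      edgeOutput m A E ++ vertexOutput m D n := by
    simp [productOutput, v₂, v₈]
  rw [e]
  exact w₁₃

end WordRAM

/-! ### Products with a fixed pattern: edge lists, degeneracy, encodings -/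

namespace SubgraphCount

/-- A fixed finite structure with which input graphs are multiplied: a symmetric relation, and a
graph that is copied into every vertex. -/
structure Pattern where
  size : ℕ
  pos : 0 < size
  rel : Fin size → Fin size → Prop
  symm : ∀ a b, rel a b → rel b a
  fiber : SimpleGraph (Fin size)

namespace Pattern

/-- The product of a graph with a pattern. -/
def prod (P : Pattern) {V : Type*} (G : SimpleGraph V) : SimpleGraph (V × Fin P.size) where
  Adj x y := (G.Adj x.1 y.1 ∧ P.rel x.2 y.2) ∨ (x.1 = y.1 ∧ P.fiber.Adj x.2 y.2)
  symm := ⟨fun _ _ h => h.imp (fun h => ⟨h.1.symm, P.symm _ _ h.2⟩) fun h => ⟨h.1.symm, h.2.symm⟩⟩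
  loopless := ⟨fun _ h => h.elim (fun h => G.loopless.irrefl _ h.1)
    fun h => P.fiber.loopless.irrefl _ h.2⟩

/-- The product of a graph with a pattern, as an input graph. -/
def finProd (P : Pattern) {n : ℕ} (G : SimpleGraph (Fin n)) : SimpleGraph (Fin (n * P.size)) :=
  (P.prod G).comap finProdFinEquiv.symm

theorem finProd_adj (P : Pattern) {n : ℕ} (G : SimpleGraph (Fin n)) (x y : Fin n × Fin P.size) :
    (P.finProd G).Adj (finProdFinEquiv x) (finProdFinEquiv y) ↔
      (G.Adj x.1 y.1 ∧ P.rel x.2 y.2) ∨ (x.1 = y.1 ∧ P.fiber.Adj x.2 y.2) := by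
  simp [finProd, prod]

open Classical in
/-- The pairs in relation, as a list. -/
noncomputable def relList (P : Pattern) : List (Fin P.size × Fin P.size) :=
  (Finset.univ.filter fun ab => P.rel ab.1 ab.2).toList

open Classical in
/-- The edges of the fiber, as a list. -/
noncomputable def fiberList (P : Pattern) : List (Fin P.size × Fin P.size) :=
  (Finset.univ.filter fun ab => P.fiber.Adj ab.1 ab.2 ∧ ab.1 < ab.2).toList

/-- The edge list of the product. -/
noncomputable def edges (P : Pattern) {n : ℕ} (L : List (Fin n × Fin n)) :
    List (Fin (n * P.size) × Fin (n * P.size)) :=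
  (L.flatMap fun e => P.relList.map fun ab =>
      (finProdFinEquiv (e.1, ab.1), finProdFinEquiv (e.2, ab.2))) ++
    (List.finRange n).flatMap fun u => P.fiberList.map fun ab =>
      (finProdFinEquiv (u, ab.1), finProdFinEquiv (u, ab.2))

theorem mem_edges (P : Pattern) {n : ℕ} (L : List (Fin n × Fin n)) (x y : Fin n × Fin P.size) :
    (finProdFinEquiv x, finProdFinEquiv y) ∈ P.edges L ↔
      ((x.1, y.1) ∈ L ∧ P.rel x.2 y.2) ∨
        (x.1 = y.1 ∧ P.fiber.Adj x.2 y.2 ∧ x.2 < y.2) := by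
  obtain ⟨u, a⟩ := x
  obtain ⟨v, b⟩ := y
  simp only [edges, relList, fiberList, List.mem_append, List.mem_flatMap, List.mem_map,
    Finset.mem_toList, Finset.mem_filter, Finset.mem_univ, true_and, Prod.mk.injEq,
    EmbeddingLike.apply_eq_iff_eq, List.mem_finRange]
  constructor
  · rintro (⟨e, he, ab, hab, ⟨rfl, rfl⟩, rfl, rfl⟩ | ⟨w, ab, hab, ⟨rfl, rfl⟩, rfl, rfl⟩)
    · exact Or.inl ⟨he, hab⟩
    · exact Or.inr ⟨rfl, hab⟩
  · rintro (⟨he, hab⟩ | ⟨rfl, hab⟩)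
    · exact Or.inl ⟨_, he, (a, b), hab, ⟨rfl, rfl⟩, rfl, rfl⟩
    · exact Or.inr ⟨u, (a, b), hab, ⟨rfl, rfl⟩, rfl, rfl⟩

end Pattern

theorem mem_map_sym2 {α : Type*} (L : List (α × α)) (u v : α) :
    s(u, v) ∈ L.map (fun e => s(e.1, e.2)) ↔ (u, v) ∈ L ∨ (v, u) ∈ L := by
  simp only [List.mem_map, Sym2.eq_iff, Prod.exists]
  constructor
  · rintro ⟨a, b, h, ⟨rfl, rfl⟩ | ⟨rfl, rfl⟩⟩
    · exact Or.inl h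
    · exact Or.inr h
  · rintro (h | h)
    · exact ⟨u, v, h, Or.inl ⟨rfl, rfl⟩⟩
    · exact ⟨v, u, h, Or.inr ⟨rfl, rfl⟩⟩

theorem IsEdgeList.not_mem_swap {n : ℕ} {G : SimpleGraph (Fin n)} {L : List (Fin n × Fin n)}
    (h : IsEdgeList G L) {u v : Fin n} (huv : (u, v) ∈ L) : (v, u) ∉ L := by
  intro hvu
  have := List.inj_on_of_nodup_map h.1 huv hvu (Sym2.eq_swap)
  obtain rfl : u = v := congrArg Prod.fst this
  exact G.loopless.irrefl _ ((h.2 u u).2 ((mem_map_sym2 _ _ _).2 (Or.inl huv)))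

/-- `L` contains one orientation of each edge, so running through all ordered related pairs produces
each edge between different copies exactly once. Inside a copy, the condition `a < b` built into
`fiberList` selects one orientation. -/
theorem isEdgeList_finProd (P : Pattern) {n : ℕ} {G : SimpleGraph (Fin n)}
    {L : List (Fin n × Fin n)} (h : IsEdgeList G L) :
    IsEdgeList (P.finProd G) (P.edges L) := by
  have adj : ∀ u v, G.Adj u v ↔ (u, v) ∈ L ∨ (v, u) ∈ L := fun u v => by
    rw [h.2, mem_map_sym2]
  constructor
  · refine List.Nodup.map_on ?_ ?_
    · rintro ⟨X, Y⟩ hx ⟨X', Y'⟩ hy hxy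
      obtain ⟨⟨u, a⟩, rfl⟩ := finProdFinEquiv.surjective X
      obtain ⟨⟨v, b⟩, rfl⟩ := finProdFinEquiv.surjective Y
      rcases Sym2.eq_iff.1 hxy with ⟨rfl, rfl⟩ | ⟨rfl, rfl⟩
      · rfl
      · exfalso
        rw [P.mem_edges] at hx hy
        -- A pair and its reversal both occur in the list: either `L` contains both orientations of
        -- an edge, or it contains a loop (the two mixed cases), or `<` fails to be asymmetric.
        rcases hx with ⟨h1, -⟩ | ⟨h1, -, h2⟩ <;> rcases hy with ⟨h3, -⟩ | ⟨h3, -, h4⟩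
        · exact h.not_mem_swap h1 h3
        · simp only at h1 h3
          subst h3
          exact h.not_mem_swap h1 h1
        · simp only at h1 h3
          subst h1
          exact h.not_mem_swap h3 h3
        · exact lt_asymm h2 h4
    · have hL : L.Nodup := List.Nodup.of_map _ h.1
      have e1 : P.edges L = (L.product P.relList).map (fun x => (finProdFinEquiv (x.1.1, x.2.1),
            finProdFinEquiv (x.1.2, x.2.2))) ++
          ((List.finRange n).product P.fiberList).map (fun x => (finProdFinEquiv (x.1, x.2.1),
            finProdFinEquiv (x.1, x.2.2))) := by
        simp [Pattern.edges, List.product, List.map_flatMap, Function.comp_def]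
      rw [e1]
      refine List.Nodup.append (List.Nodup.map ?_ (hL.product (Finset.nodup_toList _)))
        (List.Nodup.map ?_ ((List.nodup_finRange n).product (Finset.nodup_toList _))) ?_
      · rintro ⟨⟨u, v⟩, a, b⟩ ⟨⟨u', v'⟩, a', b'⟩ hxy
        simp only [Prod.mk.injEq, EmbeddingLike.apply_eq_iff_eq] at hxy ⊢
        tauto
      · rintro ⟨u, a, b⟩ ⟨u', a', b'⟩ hxy
        simp only [Prod.mk.injEq, EmbeddingLike.apply_eq_iff_eq] at hxy ⊢
        tauto
      · intro z hz hz'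
        obtain ⟨⟨⟨u, v⟩, a, b⟩, hm, rfl⟩ := List.mem_map.1 hz
        obtain ⟨⟨w, a', b'⟩, -, he⟩ := List.mem_map.1 hz'
        simp only [Prod.mk.injEq, EmbeddingLike.apply_eq_iff_eq] at he
        obtain ⟨⟨rfl, -⟩, rfl, -⟩ := he
        have := (List.pair_mem_product.1 hm).1
        exact h.not_mem_swap this this
  · intro X Y
    obtain ⟨⟨u, a⟩, rfl⟩ := finProdFinEquiv.surjective X
    obtain ⟨⟨v, b⟩, rfl⟩ := finProdFinEquiv.surjective Y
    rw [mem_map_sym2, P.mem_edges, P.mem_edges, P.finProd_adj]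
    simp only [adj]
    constructor
    · rintro (⟨h1 | h1, h2⟩ | ⟨rfl, h2⟩)
      · exact Or.inl (Or.inl ⟨h1, h2⟩)
      · exact Or.inr (Or.inl ⟨h1, P.symm _ _ h2⟩)
      · rcases lt_or_gt_of_ne h2.ne with h3 | h3
        · exact Or.inl (Or.inr ⟨rfl, h2, h3⟩)
        · exact Or.inr (Or.inr ⟨rfl, h2.symm, h3⟩)
    · rintro ((⟨h1, h2⟩ | ⟨rfl, h2, -⟩) | (⟨h1, h2⟩ | ⟨rfl, h2, -⟩))
      · exact Or.inl ⟨Or.inl h1, h2⟩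
      · exact Or.inr ⟨rfl, h2⟩
      · exact Or.inl ⟨Or.inr h1, P.symm _ _ h2⟩
      · exact Or.inr ⟨rfl, h2.symm⟩

/-- Order the product lexicographically, copies first. The later neighbours of `(u, a)` lie over `u`
or over one of the at most `κ` later neighbours of `u`. -/
theorem isDegenerate_finProd (P : Pattern) {n κ : ℕ} {G : SimpleGraph (Fin n)}
    (h : IsDegenerate κ G) : IsDegenerate ((κ + 1) * P.size) (P.finProd G) := by
  obtain ⟨σ, hσ⟩ := h
  refine ⟨finProdFinEquiv.symm.trans ((Equiv.prodCongr σ (Equiv.refl _)).trans finProdFinEquiv),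
    fun X => ?_⟩
  obtain ⟨⟨u, a⟩, rfl⟩ := finProdFinEquiv.surjective X
  set S : Set (Fin n) := insert u {w | G.Adj u w ∧ σ u < σ w}
  have hS : S.ncard ≤ κ + 1 := (Set.ncard_insert_le _ _).trans (Nat.add_le_add_right (hσ u) 1)
  have hT : (S ×ˢ (Set.univ : Set (Fin P.size))).ncard ≤ (κ + 1) * P.size := by
    rw [Set.ncard_prod, Set.ncard_univ, Nat.card_eq_fintype_card, Fintype.card_fin]
    exact Nat.mul_le_mul_right _ hS
  refine le_trans (le_trans (Set.ncard_le_ncard ?_ (Set.toFinite _))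
    (Set.ncard_image_le (f := finProdFinEquiv) (Set.toFinite _))) hT
  intro Y hY
  obtain ⟨⟨v, b⟩, rfl⟩ := finProdFinEquiv.surjective Y
  refine ⟨(v, b), ⟨?_, trivial⟩, rfl⟩
  obtain ⟨h1, h2⟩ := hY
  rw [P.finProd_adj] at h1
  rcases h1 with ⟨h1, -⟩ | ⟨h1, -⟩
  · refine Or.inr ⟨h1, ?_⟩
    by_contra hlt
    have hne : σ v ≠ σ u := fun e => h1.ne (σ.injective e).symm
    have hlt' : (σ v : ℕ) < σ u := Fin.lt_def.1 (lt_of_le_of_ne (not_lt.1 hlt) hne)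
    simp only [Equiv.trans_apply, Equiv.symm_apply_apply, Equiv.prodCongr_apply, Prod.map,
      Equiv.refl_apply, Fin.lt_def, finProdFinEquiv_apply_val] at h2
    have : P.size * (σ v : ℕ) + P.size ≤ P.size * (σ u : ℕ) := by
      calc P.size * (σ v : ℕ) + P.size = P.size * ((σ v : ℕ) + 1) := by ring
        _ ≤ _ := Nat.mul_le_mul_left _ hlt'
    have := b.2
    omega
  · exact Or.inl h1.symm

/-- Gives every graph some degeneracy bound, for the conclusions in which `κ` does not appear. -/
theorem isDegenerate_self {n : ℕ} (G : SimpleGraph (Fin n)) : IsDegenerate n G :=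
  ⟨Equiv.refl _, fun v => by
    refine (Set.ncard_le_ncard (Set.subset_univ _) (Set.toFinite _)).trans ?_
    simp [Set.ncard_univ]⟩

/-- Charge each edge to its earlier endpoint in the degeneracy order. Hence reading the input and
writing a product take time linear in `n` for fixed `κ`. -/
theorem IsEdgeList.length_le {n κ : ℕ} {G : SimpleGraph (Fin n)} {L : List (Fin n × Fin n)}
    (h : IsEdgeList G L) (hκ : IsDegenerate κ G) : L.length ≤ κ * n := by
  classical
  obtain ⟨σ, hσ⟩ := hκ
  let orient : Fin n × Fin n → Σ _ : Fin n, Fin n :=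
    fun e => if σ e.1 < σ e.2 then ⟨e.1, e.2⟩ else ⟨e.2, e.1⟩
  have hs : ∀ e, s((orient e).1, (orient e).2) = s(e.1, e.2) := by
    intro e
    simp only [orient]
    split_ifs
    · rfl
    · exact Sym2.eq_swap
  have hnd : (L.map orient).Nodup := by
    refine List.Nodup.of_map (fun x => s(x.1, x.2)) ?_
    rw [List.map_map]
    simpa only [Function.comp_def, hs] using h.1
  let T : Finset (Σ _ : Fin n, Fin n) :=
    Finset.univ.sigma fun v => Finset.univ.filter fun w => G.Adj v w ∧ σ v < σ w
  have hsub : (L.map orient).toFinset ⊆ T := by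
    intro x hx
    obtain ⟨⟨u, v⟩, he, rfl⟩ := List.mem_map.1 (List.mem_toFinset.1 hx)
    have hadj : G.Adj u v := (h.2 u v).2 ((mem_map_sym2 _ _ _).2 (Or.inl he))
    have hne : σ u ≠ σ v := fun e => hadj.ne (σ.injective e)
    simp only [T, Finset.mem_sigma, Finset.mem_univ, true_and, Finset.mem_filter, orient]
    split_ifs with hlt
    · exact ⟨hadj, hlt⟩
    · exact ⟨hadj.symm, lt_of_le_of_ne (not_lt.1 hlt) hne.symm⟩
  calc L.length = (L.map orient).toFinset.card := by
        rw [List.toFinset_card_of_nodup hnd, List.length_map]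
    _ ≤ T.card := Finset.card_le_card hsub
    _ = ∑ v, (Finset.univ.filter fun w => G.Adj v w ∧ σ v < σ w).card := Finset.card_sigma _ _
    _ ≤ ∑ _v : Fin n, κ := by
        refine Finset.sum_le_sum fun v _ => ?_
        rw [← Set.ncard_coe_finset]
        simpa using hσ v
    _ = κ * n := by simp [mul_comm]

/-- Pairs of vertices as pairs of numbers. -/
def natPairs {m : ℕ} (l : List (Fin m × Fin m)) : List (ℕ × ℕ) :=
  l.map fun e => ((e.1 : ℕ), (e.2 : ℕ))

theorem natPairs_lt {m : ℕ} (l : List (Fin m × Fin m)) : ∀ e ∈ natPairs l, e.1 < m ∧ e.2 < m := by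
  intro e he
  obtain ⟨x, -, rfl⟩ := List.mem_map.1 he
  exact ⟨x.1.2, x.2.2⟩

/-- The order of `Pattern.edges` is the order in which the machine writes, so the two lists agree
literally. -/
theorem encode_edges (P : Pattern) {n : ℕ} (L : List (Fin n × Fin n)) :
    encode (n * P.size) (P.edges L) =
      WordRAM.productOutput P.size n (natPairs P.relList) (natPairs P.fiberList) (natPairs L) := by
  have hr : List.range n = (List.finRange n).map Fin.val := by simp
  simp only [encode, WordRAM.productOutput, Pattern.edges, WordRAM.edgeOutput,
    WordRAM.vertexOutput, natPairs, hr, List.flatMap_append, List.length_append,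
    List.length_flatMap, List.length_map, List.flatMap_map, List.flatMap_assoc,
    List.map_const', List.sum_replicate, smul_eq_mul, List.length_finRange,
    finProdFinEquiv_apply_val, Nat.mul_comm P.size, Nat.add_comm]

theorem encode_getD {n : ℕ} (L : List (Fin n × Fin n)) :
    (encode n L).getD 0 0 = n ∧ (encode n L).getD 1 0 = L.length ∧
      ∀ i (hi : i < (natPairs L).length),
        (encode n L).getD (2 + 2 * i) 0 = (natPairs L)[i].1 ∧
        (encode n L).getD (3 + 2 * i) 0 = (natPairs L)[i].2 := by
  refine ⟨rfl, rfl, ?_⟩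
  have key : ∀ (L : List (Fin n × Fin n)) i (hi : i < (natPairs L).length),
      (L.flatMap fun e => [(e.1 : ℕ), (e.2 : ℕ)]).getD (2 * i) 0 = (natPairs L)[i].1 ∧
      (L.flatMap fun e => [(e.1 : ℕ), (e.2 : ℕ)]).getD (2 * i + 1) 0 = (natPairs L)[i].2 := by
    intro L
    induction L with
    | nil => intro i hi; simp [natPairs] at hi
    | cons e L ih =>
      intro i hi
      rcases i with _ | i
      · exact ⟨rfl, rfl⟩
      · exact ih i (by simpa [natPairs] using hi)
  intro i hi
  have e2 : 2 + 2 * i = 2 * i + 1 + 1 := by ring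
  have e3 : 3 + 2 * i = 2 * i + 1 + 1 + 1 := by ring
  rw [e2, e3]
  exact key L i hi

theorem encode_getD_of_le {n : ℕ} (L : List (Fin n × Fin n)) {i : ℕ} (hi : 2 * L.length + 2 ≤ i) :
    (encode n L).getD i 0 = 0 := by
  refine List.getD_eq_default _ _ ?_
  simp only [encode, List.length_cons, WordRAM.length_flatMap_pair]
  omega

theorem encode_getD_lt {n : ℕ} (L : List (Fin n × Fin n)) {B : ℕ} (hn : n < B)
    (hL : L.length < B) (i : ℕ) : (encode n L).getD i 0 < B := by
  by_cases hi : i < (encode n L).length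
  · rw [List.getD_eq_getElem _ _ hi]
    have : ∀ x ∈ encode n L, x < B := by
      simp only [encode, List.mem_cons, List.mem_flatMap, List.not_mem_nil, or_false]
      rintro x (rfl | rfl | ⟨e, -, rfl | rfl⟩)
      · exact hn
      · exact hL
      · exact e.1.2.trans hn
      · exact e.2.2.trans hn
    exact this _ (List.getElem_mem hi)
  · rw [List.getD_eq_default _ _ (not_lt.1 hi)]
    omega

end SubgraphCount

/-! ### Calling a subroutine on a product of the input -/

namespace WordRAM

/-- Write the encoding of a product of the input graph, and run `p` on it. -/
def call (j m : ℕ) (A D : List (ℕ × ℕ)) (p : Prog) : Prog :=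
  .seq (writeProduct j m A D) (p.reloc j)

end WordRAM

namespace SubgraphCount

open WordRAM

/-- The continuation may assume that registers from 16 on and memory cells outside the callee's
parity class are unchanged. This protects the input, the work area of a second call and the result
of an earlier one. -/
theorem Pattern.cost_call_le (P : Pattern) {n j B B' y y' : ℕ} {L : List (Fin n × Fin n)}
    {s : State} {p : Prog} {k : List Prog} {K : ℝ≥0∞} (hs : s.Fits B')
    (hin : ∀ i < 2 * L.length + 2, s.mem i = (encode n L).getD i 0)
    (hz : ∀ a, s.mem (2 * L.length + 2 + j + 2 * a) = 0) (hr : ∀ r, s.reg (relocReg j r) = 0)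
    (hB : 2 * L.length + 2 + j + 4 * (L.length * P.relList.length + n * P.fiberList.length) + 4 +
      n * P.size + P.size + P.relList.length + P.fiberList.length < B')
    (hB' : 2 * L.length + 2 + j + 2 * B ≤ B')
    (hK : ∀ s' : State, s'.Fits B' → y < B → s'.reg (relocReg j 0) = y →
      (∀ i, 16 ≤ i → (∀ r, i ≠ relocReg j r) → s'.reg i = s.reg i) →
      (∀ x, (∀ a, x ≠ 2 * L.length + 2 + j + 2 * a) → s'.mem x = s.mem x) →
        cost B' y' ⟨k, s'⟩ ≤ K) :
    cost B' y' ⟨call j P.size (natPairs P.relList) (natPairs P.fiberList) p :: k, s⟩ ≤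
      ((16 * P.relList.length + 16) * L.length + (16 * P.fiberList.length + 16) * n + 101 : ℕ) +
        5 * cost B y (start p (encode (n * P.size) (P.edges L))) + K := by
  have lenA : (natPairs P.relList).length = P.relList.length := List.length_map _
  have lenD : (natPairs P.fiberList).length = P.fiberList.length := List.length_map _
  have lenE : (natPairs L).length = L.length := List.length_map _
  obtain ⟨g0, g1, g2⟩ := encode_getD L
  obtain ⟨s₁, w, x⟩ := exec_writeProduct (n := n) (j := j) (B := B')
    (natPairs P.relList) (natPairs P.fiberList) (natPairs L) (natPairs_lt _)
    (natPairs_lt _) (natPairs_lt _) hs (by rw [hin _ (by omega), g0])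
    (by rw [hin _ (by omega), g1, lenE])
    (fun i hi => by
      rw [hin _ (by omega), hin _ (by omega)]
      exact g2 i hi)
    (by rw [lenE]) hz (by rw [lenA, lenD, lenE]; omega)
  rw [lenA, lenD, lenE] at x
  rw [call, cost_det (c' := ⟨writeProduct j P.size (natPairs P.relList) (natPairs P.fiberList) ::
    p.reloc j :: k, s⟩) hs rfl]
  refine (add_le_add le_rfl ((x hs).2 y' _)).trans ?_
  have hrep : Represents j (2 * L.length + 2 + j) B' s
      (start p (encode (n * P.size) (P.edges L))).state s₁ :=
    { reg := fun r => by
        rw [w.otherReg _ (by unfold relocReg; omega), hr]; rfl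
      mem := fun a => by rw [w.cells, encode_edges]; rfl
      base := w.base
      fits := w.fits
      otherReg := fun i hi _ => w.otherReg i hi
      otherMem := w.otherMem }
  have := cost_reloc_le (p := p) (k := k) (K := K) (y := y) (y' := y') hB' (fun t t' ht hf hy =>
    hK t' ht.fits (hy ▸ (hf 0).1) (by rw [ht.reg, hy]) ht.otherReg ht.otherMem) hrep
  refine (add_le_add le_rfl (add_le_add le_rfl this)).trans (le_of_eq ?_)
  rw [start]
  push_cast
  ring

/-! ### Easy problems -/

/-- The word bound and the correctness of the output are required without reference to `κ`; they
follow from finiteness of the cost for `κ = n`. -/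
theorem isEasy_iff_cost (count : ∀ n : ℕ, SimpleGraph (Fin n) → ℕ) :
    IsEasy count ↔ ∃ (p : Prog) (c : ℕ) (f : ℕ → ℕ), ∀ n : ℕ, 1 ≤ n →
      ∀ (G : SimpleGraph (Fin n)) (L : List (Fin n × Fin n)), IsEdgeList G L →
        ∀ κ, IsDegenerate κ G →
          cost ((n + 1) ^ c) (count n G) (start p (encode n L)) ≤ (f κ : ℝ≥0∞) * (n : ℝ≥0∞) := by
  constructor
  · rintro ⟨p, c, f, h⟩
    refine ⟨p, c, f, fun n hn G L hL κ hκ => ?_⟩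
    obtain ⟨h1, h2, h3⟩ := h n hn G L hL
    exact (cost_le_expectedTime h1 h2).trans (h3 κ hκ)
  · rintro ⟨p, c, f, h⟩
    refine ⟨p, c, f, fun n hn G L hL => ?_⟩
    have htop : cost ((n + 1) ^ c) (count n G) (start p (encode n L)) ≠ ⊤ :=
      ne_top_of_le_ne_top (ENNReal.mul_ne_top (ENNReal.natCast_ne_top _)
        (ENNReal.natCast_ne_top _)) (h n hn G L hL n (isDegenerate_self G))
    exact ⟨fitsWords_of_cost_ne_top htop, outputs_of_cost_ne_top htop, fun κ hκ =>
      (expectedTime_le_cost _ _ _).trans (h n hn G L hL κ hκ)⟩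

/-- As `n + 1 ≥ 2`, constant factors can be absorbed into the exponent of the word bound. -/
theorem mul_pow_lt_pow {n : ℕ} (hn : 1 ≤ n) (K d : ℕ) : K * (n + 1) ^ d < (n + 1) ^ (K + d) := by
  rw [pow_add]
  refine Nat.mul_lt_mul_of_pos_right ?_ (by positivity)
  exact K.lt_two_pow_self.trans_le (Nat.pow_le_pow_left (by omega) K)

theorem start_fits {n : ℕ} {B : ℕ} (p : Prog) (L : List (Fin n × Fin n)) (hn : n < B)
    (hL : L.length < B) : (start p (encode n L)).state.Fits B := fun i =>
  ⟨by simp only [start]; omega, encode_getD_lt L hn hL i⟩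

theorem isEasy_const (m : ℕ) : IsEasy fun _ _ => m := by
  rw [isEasy_iff_cost]
  refine ⟨.const 0 m, m + 3, fun _ => 1, fun n hn G L hL κ _ => ?_⟩
  have hlen : L.length ≤ n * n := hL.length_le (isDegenerate_self G)
  have hB : (m + 1) * (n + 1) ^ 2 < (n + 1) ^ (m + 3) := mul_pow_lt_pow hn (m + 1) 2
  have h2 : n * n + n < (n + 1) ^ 2 := by nlinarith
  have hm : (n + 1) ^ 2 * (m + 1) = (m + 1) * (n + 1) ^ 2 := mul_comm _ _
  have h1 : (n + 1) ^ 2 ≤ (m + 1) * (n + 1) ^ 2 := Nat.le_mul_of_pos_left _ (by omega)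
  have h3 : m + 1 ≤ (m + 1) * (n + 1) ^ 2 := Nat.le_mul_of_pos_right _ (by positivity)
  have hs := start_fits (B := (n + 1) ^ (m + 3)) (.const 0 m) L (by omega) (by omega)
  have hx := Exec.const (start (.const 0 m) (encode n L)).state 0 (x := m)
    (B := (n + 1) ^ (m + 3)) (by omega) hs
  refine (hx.2 m []).trans ?_
  rw [cost_halted hx.1 (by simp [State.setReg_reg])]
  simpa using hn

/-- The operations whose results are at most polynomial in the operands. -/
def PolyOp (o : Op) : Prop := ∀ x y, o.eval x y ≤ (x + 1) * (y + 1)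

theorem polyOp_add : PolyOp .add := fun x y => by simp only [Op.eval]; nlinarith [Nat.zero_le (x * y)]
theorem polyOp_sub : PolyOp .sub := fun x y => by
  simp only [Op.eval]; nlinarith [Nat.zero_le (x * y), Nat.sub_le x y]
theorem polyOp_div : PolyOp .div := fun x y => by
  simp only [Op.eval]; nlinarith [Nat.zero_le (x * y), Nat.div_le_self x y]

namespace Pattern

/-- The number of steps for writing the product with `P`, per vertex of a `κ`-degenerate graph. -/
noncomputable def overhead (P : Pattern) (κ : ℕ) : ℕ :=
  (16 * P.relList.length + 16) * κ + (16 * P.fiberList.length + 16) + 101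

theorem overhead_bound (P : Pattern) {n κ l : ℕ} (hn : 1 ≤ n) (hl : l ≤ κ * n) :
    (16 * P.relList.length + 16) * l + (16 * P.fiberList.length + 16) * n + 101 ≤
      P.overhead κ * n := by
  have := Nat.mul_le_mul_left (16 * P.relList.length + 16) hl
  unfold overhead
  nlinarith

/-- A bound for the numbers that occur when the product with `P` is written. -/
theorem word_bound (P : Pattern) {n l j : ℕ} (hl : l ≤ n * n) (hj : j ≤ 1) :
    2 * l + 2 + j + 4 * (l * P.relList.length + n * P.fiberList.length) + 4 + n * P.size + P.size +
      P.relList.length + P.fiberList.length ≤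
    (7 + 2 * P.size + 5 * P.relList.length + 5 * P.fiberList.length) * (n + 1) ^ 2 := by
  have h1 : l * P.relList.length ≤ n * n * P.relList.length := Nat.mul_le_mul_right _ hl
  have hN : (n + 1) ^ 2 = n * n + 2 * n + 1 := by ring
  rw [hN]
  have e1 : 0 ≤ n * n * P.size := Nat.zero_le _
  have e2 : 0 ≤ n * P.size := Nat.zero_le _
  have e3 : 0 ≤ n * n * P.fiberList.length := Nat.zero_le _
  have e4 : 0 ≤ n * P.relList.length := Nat.zero_le _
  nlinarith

/-- Bernoulli's inequality: words for the product are longer only by a constant factor. -/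
theorem word_pow_le (P : Pattern) (n c : ℕ) :
    (n * P.size + 1) ^ c ≤ (n + 1) ^ (P.size * c) := by
  rw [pow_mul]
  refine Nat.pow_le_pow_left ?_ c
  induction P.size with
  | zero => simp
  | succ m ih =>
    rw [pow_succ]
    nlinarith [Nat.zero_le (n * (n * m))]

end Pattern

/-- Run `p` on the product with `P` in the even slots, then `q` on the product with `Q` in the odd
slots. Their outputs are in registers 16 and 17, which are `relocReg 0 0` and `relocReg 1 0`. -/
theorem IsEasy.op {f g : ∀ n : ℕ, SimpleGraph (Fin n) → ℕ} (hf : IsEasy f) (hg : IsEasy g)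
    {o : Op} (ho : PolyOp o) (P Q : Pattern) :
    IsEasy fun n G => o.eval (f _ (P.finProd (n := n) G)) (g _ (Q.finProd (n := n) G)) := by
  rw [isEasy_iff_cost] at hf hg ⊢
  obtain ⟨p, c, u, hp⟩ := hf
  obtain ⟨q, d, v, hq⟩ := hg
  obtain ⟨a, ha⟩ : ∃ a, a = 7 + 2 * P.size + 5 * P.relList.length + 5 * P.fiberList.length :=
    ⟨_, rfl⟩
  obtain ⟨b, hb⟩ : ∃ b, b = 7 + 2 * Q.size + 5 * Q.relList.length + 5 * Q.fiberList.length :=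
    ⟨_, rfl⟩
  refine ⟨.seq (call 0 P.size (natPairs P.relList) (natPairs P.fiberList) p)
      (.seq (call 1 Q.size (natPairs Q.relList) (natPairs Q.fiberList) q) (.op o 0 16 17)),
    (7 + a + b) + (2 + P.size * c + Q.size * d),
    -- The 3 stands for two `seq` and the final operation. The factors 5 are the slowdown of
    -- relocation, and `(κ + 1) * size` is the degeneracy of the products.
    fun κ => 3 + P.overhead κ + 5 * (u ((κ + 1) * P.size) * P.size) + Q.overhead κ +
      5 * (v ((κ + 1) * Q.size) * Q.size), fun n hn G L hL κ hκ => ?_⟩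
  obtain ⟨y, hy⟩ : ∃ y, y = f _ (P.finProd G) := ⟨_, rfl⟩
  obtain ⟨z, hz⟩ : ∃ z, z = g _ (Q.finProd G) := ⟨_, rfl⟩
  rw [← hy, ← hz]
  have hlen : L.length ≤ n * n := hL.length_le (isDegenerate_self G)
  have costp := hp (n * P.size) (Nat.mul_pos hn P.pos) _ _ (isEdgeList_finProd P hL) _
    (isDegenerate_finProd P hκ)
  have costq := hq (n * Q.size) (Nat.mul_pos hn Q.pos) _ _ (isEdgeList_finProd Q hL) _
    (isDegenerate_finProd Q hκ)
  rw [← hy] at costp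
  rw [← hz] at costq
  set N := n + 1 with hN
  obtain ⟨B, hB⟩ : ∃ B, B = N ^ ((7 + a + b) + (2 + P.size * c + Q.size * d)) := ⟨_, rfl⟩
  obtain ⟨X, hX⟩ : ∃ X, X = (n * P.size + 1) ^ c := ⟨_, rfl⟩
  obtain ⟨Y, hY⟩ : ∃ Y, Y = (n * Q.size + 1) ^ d := ⟨_, rfl⟩
  rw [← hX] at costp
  rw [← hY] at costq
  rw [← hB]
  -- `M` dominates `N ^ 2`, the word bounds `X` and `Y` of the subroutines, and `X * Y`; a constant
  -- multiple of it stays below `B`.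
  obtain ⟨M, hM⟩ : ∃ M, M = N ^ (2 + P.size * c + Q.size * d) := ⟨_, rfl⟩
  have hlt : (7 + a + b) * M < B := by rw [hM, hB]; exact mul_pow_lt_pow hn _ _
  have hN1 : 1 ≤ N := by omega
  have hXM : X ≤ M := by
    rw [hX, hM]
    exact (P.word_pow_le n c).trans (Nat.pow_le_pow_right hN1 (by omega))
  have hYM : Y ≤ M := by
    rw [hY, hM]
    exact (Q.word_pow_le n d).trans (Nat.pow_le_pow_right hN1 (by omega))
  have hXY : X * Y ≤ M := by
    rw [hX, hY, hM]
    refine (Nat.mul_le_mul (P.word_pow_le n c) (Q.word_pow_le n d)).trans ?_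
    rw [← pow_add]
    exact Nat.pow_le_pow_right hN1 (by omega)
  have hN2 : N ^ 2 ≤ M := by
    rw [hM]
    exact Nat.pow_le_pow_right hN1 (by omega)
  have hnN : n * n + 2 * n + 1 = N ^ 2 := by rw [hN]; ring
  have expand : (7 + a + b) * M = 7 * M + a * M + b * M := by ring
  have haM : a * N ^ 2 ≤ a * M := Nat.mul_le_mul_left _ hN2
  have hbM : b * N ^ 2 ≤ b * M := Nat.mul_le_mul_left _ hN2
  have wP := P.word_bound (j := 0) hlen (by omega)
  have wQ := Q.word_bound (j := 1) hlen (by omega)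
  rw [← ha, ← hN] at wP
  rw [← hb, ← hN] at wQ
  set s := (start (.seq (call 0 P.size (natPairs P.relList) (natPairs P.fiberList) p)
      (.seq (call 1 Q.size (natPairs Q.relList) (natPairs Q.fiberList) q) (.op o 0 16 17)))
    (encode n L)).state with hs
  have hfit : s.Fits B := start_fits _ L (by omega) (by omega)
  have mem_s : ∀ i, s.mem i = (encode n L).getD i 0 := fun _ => rfl
  have reg_s : ∀ i, s.reg i = 0 := fun _ => rfl
  have final : ∀ t : State, t.Fits B → y < X → z < Y → t.reg 16 = y → t.reg 17 = z →
      cost B (o.eval y z) ⟨[.op o 0 16 17], t⟩ ≤ 1 := by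
    intro t ht hyX hzY h16 h17
    -- `PolyOp` bounds the result by `(y + 1) * (z + 1)`, which is at most `X * Y`.
    have hlt : o.eval y z < B := by
      have h1 := ho y z
      have h2 : (y + 1) * (z + 1) ≤ X * Y := Nat.mul_le_mul hyX hzY
      omega
    have hx := Exec.op (B := B) t o 0 16 17 (x := o.eval y z) (by rw [h16, h17]) hlt ht
    refine (hx.2 _ []).trans ?_
    rw [cost_halted hx.1 (by simp [State.setReg_reg])]
    simp
  have second : ∀ t : State, t.Fits B → y < X → t.reg 16 = y →
      (∀ i, 16 ≤ i → (∀ r, i ≠ relocReg 0 r) → t.reg i = s.reg i) →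
      (∀ x, (∀ a, x ≠ 2 * L.length + 2 + 0 + 2 * a) → t.mem x = s.mem x) →
      cost B (o.eval y z) ⟨[.seq (call 1 Q.size (natPairs Q.relList) (natPairs Q.fiberList) q)
        (.op o 0 16 17)], t⟩ ≤ 1 + ((Q.overhead κ * n : ℕ) +
          5 * ((v ((κ + 1) * Q.size) : ℝ≥0∞) * ((n * Q.size : ℕ) : ℝ≥0∞)) + 1) := by
    intro t ht hyX h16 hreg hmem
    rw [cost_det (c' := ⟨[call 1 Q.size (natPairs Q.relList) (natPairs Q.fiberList) q,
      .op o 0 16 17], t⟩) ht rfl]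
    refine add_le_add le_rfl ((Q.cost_call_le (n := n) (L := L) (j := 1) (B := Y) (y := z) ht ?_ ?_ ?_ ?_ ?_
      (K := 1) ?_).trans ?_)
    · intro i hi
      rw [hmem _ (fun a => by omega), mem_s]
    -- These cells lie behind the input and have the parity avoided by the first call, so they are
    -- still zero.
    · intro r
      rw [hmem _ (fun a => by omega), mem_s, encode_getD_of_le _ (by omega)]
    · intro r
      rw [hreg _ (by unfold relocReg; omega) (fun r' => by unfold relocReg; omega), reg_s]
    · omega
    · omega
    · intro t' ht' hzY h17 hreg' _
      refine final t' ht' hyX hzY ?_ h17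
      rw [hreg' _ le_rfl (fun r => by unfold relocReg; omega), h16]
    · gcongr
      exact_mod_cast Q.overhead_bound hn (hL.length_le hκ)
  have first : cost B (o.eval y z) ⟨[call 0 P.size (natPairs P.relList) (natPairs P.fiberList) p,
      .seq (call 1 Q.size (natPairs Q.relList) (natPairs Q.fiberList) q) (.op o 0 16 17)], s⟩ ≤
      (P.overhead κ * n : ℕ) +
        5 * ((u ((κ + 1) * P.size) : ℝ≥0∞) * ((n * P.size : ℕ) : ℝ≥0∞)) +
      (1 + ((Q.overhead κ * n : ℕ) +
          5 * ((v ((κ + 1) * Q.size) : ℝ≥0∞) * ((n * Q.size : ℕ) : ℝ≥0∞)) + 1)) := by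
    refine ((P.cost_call_le (j := 0) (B := X) (y := y) hfit (fun i _ => mem_s i) ?_ (fun _ => reg_s _) ?_ ?_
      second).trans ?_)
    · intro r
      rw [mem_s, encode_getD_of_le _ (by omega)]
    · omega
    · omega
    · gcongr
      exact_mod_cast P.overhead_bound hn (hL.length_le hκ)
  have start_eq : start (.seq (call 0 P.size (natPairs P.relList) (natPairs P.fiberList) p)
      (.seq (call 1 Q.size (natPairs Q.relList) (natPairs Q.fiberList) q) (.op o 0 16 17)))
      (encode n L) = ⟨[.seq (call 0 P.size (natPairs P.relList) (natPairs P.fiberList) p)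
      (.seq (call 1 Q.size (natPairs Q.relList) (natPairs Q.fiberList) q) (.op o 0 16 17))], s⟩ :=
    rfl
  rw [start_eq, cost_det (c' := ⟨[call 0 P.size (natPairs P.relList) (natPairs P.fiberList) p,
      .seq (call 1 Q.size (natPairs Q.relList) (natPairs Q.fiberList) q) (.op o 0 16 17)], s⟩)
      hfit rfl]
  refine (add_le_add le_rfl first).trans ?_
  norm_cast
  nlinarith

end SubgraphCount

namespace SubgraphCount

open WordRAM

/-! ### Closure properties -/

/-- Multiplication with this pattern changes nothing. -/
def Pattern.unit : Pattern where
  size := 1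
  pos := one_pos
  rel _ _ := True
  symm _ _ _ := trivial
  fiber := ⊥

/-- The product is `G` itself, up to the identification of `Fin (n * 1)` with `Fin n`; this removes
the patterns from `IsEasy.op`. -/
theorem Pattern.unit_finProd (f : ∀ n : ℕ, SimpleGraph (Fin n) → ℕ) {n : ℕ}
    (G : SimpleGraph (Fin n)) : f _ (Pattern.unit.finProd G) = f n G := by
  have key : ∀ (m : ℕ) (h : m = n) (G' : SimpleGraph (Fin m)),
      (∀ x y, G'.Adj x y ↔ G.Adj (Fin.cast h x) (Fin.cast h y)) → f m G' = f n G := by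
    rintro m rfl G' h
    congr 1
    ext x y
    exact h x y
  have hsize : n * Pattern.unit.size = n := mul_one n
  refine key _ hsize _ fun X Y => ?_
  obtain ⟨⟨u, a⟩, rfl⟩ := finProdFinEquiv.surjective X
  obtain ⟨⟨v, b⟩, rfl⟩ := finProdFinEquiv.surjective Y
  have hc : ∀ (w : Fin n) (d : Fin Pattern.unit.size),
      Fin.cast hsize (finProdFinEquiv (w, d)) = w := by
    intro w d
    have hd : (d : ℕ) = 0 := Nat.lt_one_iff.1 d.2
    ext
    simp only [Fin.val_cast, finProdFinEquiv_apply_val, hd, zero_add]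
    exact one_mul _
  rw [Pattern.finProd_adj, hc, hc]
  refine ⟨?_, fun h => Or.inl ⟨h, trivial⟩⟩
  rintro (⟨h, -⟩ | ⟨-, h⟩)
  · exact h
  · exact (h : False).elim

variable {f g : ∀ n : ℕ, SimpleGraph (Fin n) → ℕ}

theorem IsEasy.op_same (hf : IsEasy f) (hg : IsEasy g) {o : Op} (ho : PolyOp o) :
    IsEasy fun n G => o.eval (f n G) (g n G) := by
  simpa only [Pattern.unit_finProd] using hf.op hg ho Pattern.unit Pattern.unit

theorem IsEasy.add (hf : IsEasy f) (hg : IsEasy g) : IsEasy fun n G => f n G + g n G :=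
  hf.op_same hg polyOp_add

theorem IsEasy.sub (hf : IsEasy f) (hg : IsEasy g) : IsEasy fun n G => f n G - g n G :=
  hf.op_same hg polyOp_sub

theorem IsEasy.div_const (hf : IsEasy f) (d : ℕ) : IsEasy fun n G => f n G / d :=
  hf.op_same (isEasy_const d) polyOp_div

theorem IsEasy.comp (hf : IsEasy f) (P : Pattern) :
    IsEasy fun n G => f _ (P.finProd (n := n) G) :=
  hf.op (isEasy_const 0) polyOp_add P Pattern.unit

/-- Integer-valued graph parameters. -/
abbrev Param := ∀ n : ℕ, SimpleGraph (Fin n) → ℤ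

/-- The differences of easy graph parameters. -/
def easyGroup : AddSubgroup Param where
  carrier := {f | ∃ a b, IsEasy a ∧ IsEasy b ∧ ∀ n G, f n G = (a n G : ℤ) - (b n G : ℤ)}
  zero_mem' := ⟨_, _, isEasy_const 0, isEasy_const 0, fun _ _ => by simp⟩
  add_mem' := by
    rintro f g ⟨a, b, ha, hb, h⟩ ⟨a', b', ha', hb', h'⟩
    refine ⟨_, _, ha.add ha', hb.add hb', fun n G => ?_⟩
    simp only [Pi.add_apply, h, h']
    push_cast
    ring
  neg_mem' := by
    rintro f ⟨a, b, ha, hb, h⟩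
    refine ⟨_, _, hb, ha, fun n G => ?_⟩
    simp only [Pi.neg_apply, h]
    ring

theorem IsEasy.mem_easyGroup (hf : IsEasy f) : (fun n G => (f n G : ℤ)) ∈ easyGroup :=
  ⟨_, _, hf, isEasy_const 0, fun _ _ => by simp⟩

/-- The parameter `f` of the product of the input graph with `P`. -/
def Param.comp (f : Param) (P : Pattern) : Param := fun _ G => f _ (P.finProd G)

theorem comp_mem_easyGroup {f : Param} (hf : f ∈ easyGroup) (P : Pattern) :
    f.comp P ∈ easyGroup := by
  obtain ⟨a, b, ha, hb, h⟩ := hf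
  exact ⟨_, _, ha.comp P, hb.comp P, fun n G => h _ _⟩

/-- For positive `d`, the equation `d * f = a - b` with `f ≥ 0` makes truncated subtraction and
integer division exact, so the machine can compute `f` as `(a - b) / d`. For negative `d`, pass to
the negative. -/
theorem isEasy_of_smul_mem {d : ℤ} (hd : d ≠ 0)
    (h : d • (fun n G => (f n G : ℤ) : Param) ∈ easyGroup) : IsEasy f := by
  have pos : ∀ k : ℕ, 0 < k → (k : ℤ) • (fun n G => (f n G : ℤ) : Param) ∈ easyGroup →
      IsEasy f := by
    rintro k hk ⟨a, b, ha, hb, h⟩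
    have : f = fun n G => (a n G - b n G) / k := by
      funext n G
      have h1 := h n G
      simp only [Pi.smul_apply, smul_eq_mul] at h1
      have h2 : a n G - b n G = f n G * k := by
        have : ((f n G * k : ℕ) : ℤ) = a n G - b n G := by push_cast; linarith
        omega
      rw [h2, Nat.mul_div_cancel _ hk]
    rw [this]
    exact (ha.sub hb).div_const k
  obtain ⟨k, rfl | rfl⟩ := d.eq_nat_or_neg
  · exact pos k (by omega) h
  · refine pos k (by omega) ?_
    rw [neg_smul] at h
    exact neg_mem_iff.1 h

theorem isEasy_of_mem (h : (fun n G => (f n G : ℤ) : Param) ∈ easyGroup) : IsEasy f :=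
  isEasy_of_smul_mem one_ne_zero (by rwa [one_smul])

/-! ### Homomorphisms to relations -/

universe u

/-- The number of maps that send edges of `K` to related pairs. -/
noncomputable def relHom {W X : Type*} (K : SimpleGraph W) (r : X → X → Prop) : ℕ :=
  Nat.card {φ : W → X // ∀ u v, K.Adj u v → r (φ u) (φ v)}

theorem hom_eq_relHom {W X : Type*} (K : SimpleGraph W) (G : SimpleGraph X) :
    hom K G = relHom K G.Adj :=
  Nat.card_congr
    { toFun := fun φ => ⟨φ, fun _ _ h => φ.map_rel h⟩
      invFun := fun φ => ⟨φ.1, fun h => φ.2 _ _ h⟩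
      left_inv := fun _ => rfl
      right_inv := fun _ => rfl }

theorem inj_eq_card {W X : Type*} (K : SimpleGraph W) (G : SimpleGraph X) :
    inj K G = Nat.card {φ : W → X // Function.Injective φ ∧
      ∀ u v, K.Adj u v → G.Adj (φ u) (φ v)} :=
  Nat.card_congr
    { toFun := fun φ => ⟨φ.1, φ.2, fun _ _ h => φ.1.map_rel h⟩
      invFun := fun φ => ⟨⟨φ.1, fun h => φ.2.2 _ _ h⟩, φ.2.1⟩
      left_inv := fun _ => rfl
      right_inv := fun _ => rfl }

theorem ind_eq_card {W X : Type*} (K : SimpleGraph W) (G : SimpleGraph X) :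
    ind K G = Nat.card {φ : W → X // Function.Injective φ ∧
      ∀ u v, G.Adj (φ u) (φ v) ↔ K.Adj u v} :=
  Nat.card_congr
    { toFun := fun φ => ⟨φ, φ.injective, fun _ _ => φ.map_adj_iff⟩
      invFun := fun φ => ⟨⟨φ.1, φ.2.1⟩, φ.2.2 _ _⟩
      left_inv := fun _ => rfl
      right_inv := fun _ => rfl }

theorem relHom_congr {W W' X X' : Type*} {K : SimpleGraph W} {K' : SimpleGraph W'}
    {r : X → X → Prop} {r' : X' → X' → Prop} (e : K ≃g K') (d : X ≃ X')
    (h : ∀ x y, r x y ↔ r' (d x) (d y)) : relHom K r = relHom K' r' :=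
  Nat.card_congr ((Equiv.arrowCongr e.toEquiv d).subtypeEquiv fun φ => by
    constructor
    · intro hφ u v huv
      exact (h _ _).1 (hφ (e.symm u) (e.symm v) (e.symm.map_adj_iff.2 huv))
    · intro hφ u v huv
      have := hφ (e u) (e v) (e.map_adj_iff.2 huv)
      change r' (d (φ (e.toEquiv.symm (e.toEquiv u)))) (d (φ (e.toEquiv.symm (e.toEquiv v)))) at this
      rwa [Equiv.symm_apply_apply, Equiv.symm_apply_apply, ← h] at this)

/-- The maps that send every edge to an edge or a single vertex. -/
noncomputable def weakHom {W X : Type*} (K : SimpleGraph W) (G : SimpleGraph X) : ℕ :=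
  relHom K fun x y => x = y ∨ G.Adj x y

theorem relHom_prod {W X Y : Type*} (K : SimpleGraph W) (r : X → X → Prop) (r' : Y → Y → Prop) :
    relHom K (fun x y : X × Y => r x.1 y.1 ∧ r' x.2 y.2) = relHom K r * relHom K r' := by
  rw [relHom, relHom, relHom, ← Nat.card_prod]
  exact Nat.card_congr
    { toFun := fun φ => (⟨fun u => (φ.1 u).1, fun u v h => (φ.2 u v h).1⟩,
        ⟨fun u => (φ.1 u).2, fun u v h => (φ.2 u v h).2⟩)
      invFun := fun φ => ⟨fun u => (φ.1.1 u, φ.2.1 u), fun u v h => ⟨φ.1.2 u v h, φ.2.2 u v h⟩⟩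
      left_inv := fun _ => rfl
      right_inv := fun _ => rfl }

/-- With empty fiber this is the categorical product, where homomorphism counts multiply. `P.rel`
may contain loops. -/
theorem hom_finProd {W : Type*} (K : SimpleGraph W) (P : Pattern) (hP : P.fiber = ⊥) {n : ℕ}
    (G : SimpleGraph (Fin n)) : hom K (P.finProd G) = hom K G * relHom K P.rel := by
  rw [hom_eq_relHom, hom_eq_relHom, ← relHom_prod]
  refine relHom_congr (.refl) finProdFinEquiv.symm fun x y => ?_
  simp [Pattern.finProd, Pattern.prod, hP]

/-- The pattern of a complete graph for the strong kind of product. -/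
def Pattern.complete (m : ℕ) (hm : 0 < m) : Pattern where
  size := m
  pos := hm
  rel a b := a ≠ b
  symm _ _ h := h.symm
  fiber := ⊤

/-- Filling the copies with cliques makes the product that of the reflexive closure of `G` with a
complete graph. The first factor thus allows edges of `K` to be contracted, and the second counts
proper colourings. -/
theorem hom_finProd_complete {W : Type*} (K : SimpleGraph W) {m : ℕ} (hm : 0 < m) {n : ℕ}
    (G : SimpleGraph (Fin n)) : hom K ((Pattern.complete m hm).finProd G) =
      weakHom K G * relHom K fun a b : Fin m => a ≠ b := by
  rw [hom_eq_relHom, weakHom, ← relHom_prod]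
  refine relHom_congr (.refl) finProdFinEquiv.symm fun x y => ?_
  set X := finProdFinEquiv.symm x
  set Y := finProdFinEquiv.symm y
  change (G.Adj X.1 Y.1 ∧ X.2 ≠ Y.2 ∨ X.1 = Y.1 ∧ X.2 ≠ Y.2) ↔ _
  tauto

/-- The homomorphism count of `K` as a graph parameter. -/
noncomputable def homParam {W : Type*} (K : SimpleGraph W) : Param := fun _ G => hom K G

/-- The injective homomorphism count of `K` as a graph parameter. -/
noncomputable def injParam {W : Type*} (K : SimpleGraph W) : Param := fun _ G => inj K G

theorem homParam_comp {W : Type*} (K : SimpleGraph W) (P : Pattern) (hP : P.fiber = ⊥) :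
    (homParam K).comp P = (relHom K P.rel : ℤ) • homParam K := by
  funext n G
  simp [homParam, Param.comp, hom_finProd K P hP, mul_comm]

/-! ### Extracting one homomorphism count from an easy combination -/

/-- Homomorphism counts to some relation tell `K` from `K'`. -/
def Distinguished {W W' : Type*} (K : SimpleGraph W) (K' : SimpleGraph W') : Prop :=
  ∃ P : Pattern, P.fiber = ⊥ ∧ relHom K P.rel ≠ relHom K' P.rel

/-- The homomorphism counts of graphs that can be told from `K`. -/
def otherHoms {W : Type u} (K : SimpleGraph W) : Set Param :=
  {f | ∃ (W' : Type u) (K' : SimpleGraph W'), Distinguished K' K ∧ f = homParam K'}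

/-- The map `F ↦ F.comp P - d • F` preserves `easyGroup` and scales each homomorphism count by its
own factor `relHom _ P.rel - d`. With `d` the count of an unwanted graph and `P` telling it from
`K`, that term dies and the coefficient of `K` stays nonzero. -/
theorem homEasy_of_mem_easyGroup {W : Type u} (K : SimpleGraph W) {f : Param}
    (hf : f ∈ easyGroup) {a : ℤ} (ha : a ≠ 0)
    (h : f - a • homParam K ∈ Submodule.span ℤ (otherHoms K)) : HomEasy K := by
  classical
  obtain ⟨N, c, g, hg⟩ := Submodule.mem_span_set'.1 h
  choose W' K' hK' hgK using fun i => (g i).2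
  -- The coefficients vary in the induction, since each elimination rescales all remaining terms.
  have key : ∀ (T : Finset (Fin N)) (a : ℤ) (c : Fin N → ℤ), a ≠ 0 →
      a • homParam K + ∑ i ∈ T, c i • homParam (K' i) ∈ easyGroup → HomEasy K := by
    intro T
    induction T using Finset.induction_on with
    | empty =>
      intro a c ha hmem
      rw [Finset.sum_empty, add_zero] at hmem
      exact isEasy_of_smul_mem ha hmem
    | insert i T hi ih =>
      intro a c ha hmem
      obtain ⟨P, hP, hne⟩ := hK' i
      obtain ⟨d, hd⟩ : ∃ d : ℤ, d = (relHom (K' i) P.rel : ℤ) := ⟨_, rfl⟩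
      refine ih (a * ((relHom K P.rel : ℤ) - d))
        (fun k => c k * ((relHom (K' k) P.rel : ℤ) - d))
        (mul_ne_zero ha (sub_ne_zero.2 (by rw [hd]; exact_mod_cast hne.symm))) ?_
      have h1 := sub_mem (comp_mem_easyGroup hmem P) (zsmul_mem hmem d)
      convert h1 using 1
      have hcomp : (a • homParam K + ∑ k ∈ insert i T, c k • homParam (K' k)).comp P =
          a • (homParam K).comp P + ∑ k ∈ insert i T, c k • (homParam (K' k)).comp P := by
        funext n G
        simp [Param.comp, Finset.sum_apply]
      rw [hcomp, homParam_comp K P hP, smul_add, Finset.smul_sum, add_sub_add_comm,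
        ← Finset.sum_sub_distrib, Finset.sum_insert hi]
      simp only [homParam_comp _ P hP]
      rw [← hd, smul_comm (c i) d, sub_self, zero_add]
      congr 1
      · module
      · refine Finset.sum_congr rfl fun k _ => ?_
        module
  refine key Finset.univ a c ha ?_
  convert hf using 1
  rw [← eq_sub_iff_add_eq', ← hg]
  exact Finset.sum_congr rfl fun i _ => by rw [hgK]

end SubgraphCount

namespace SubgraphCount

universe u

/-! ### Quotients -/

noncomputable instance fintypeSetoid (W : Type*) [Finite W] : Fintype (Setoid W) :=
  haveI := Fintype.ofFinite W
  Fintype.ofInjective (fun π : Setoid W => {x : W × W | π x.1 x.2}) fun π ρ h => by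
    ext u v
    exact Set.ext_iff.1 h (u, v)

/-- The simple graph obtained by identifying equivalent vertices. -/
def quot {W : Type*} (K : SimpleGraph W) (π : Setoid W) : SimpleGraph (Quotient π) :=
  K.map (Quotient.mk π)

theorem quot_adj {W : Type*} {K : SimpleGraph W} {π : Setoid W} {u v : W} (h : K.Adj u v)
    (hπ : ¬ π u v) : (quot K π).Adj ⟦u⟧ ⟦v⟧ :=
  SimpleGraph.map_adj_apply' h fun e => hπ (Quotient.exact e)

/-- Edges of the quotient come from the edges of `K` between different classes. The extra condition
`p` serves the injective and the unrestricted count alike. -/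
theorem relHom_quot {W X : Type*} (K : SimpleGraph W) (π : Setoid W) (r : X → X → Prop)
    (p : (Quotient π → X) → Prop) :
    Nat.card {ψ : Quotient π → X // p ψ ∧ ∀ x y, (quot K π).Adj x y → r (ψ x) (ψ y)} =
      Nat.card {ψ : Quotient π → X // p ψ ∧ ∀ u v, K.Adj u v → ¬ π u v → r (ψ ⟦u⟧) (ψ ⟦v⟧)} := by
  refine Nat.card_congr (Equiv.subtypeEquivRight fun ψ => and_congr_right fun _ => ?_)
  refine ⟨fun h u v huv hπ => h _ _ (quot_adj huv hπ), fun h x y hxy => ?_⟩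
  obtain ⟨hne, u, v, huv, rfl, rfl⟩ := (SimpleGraph.map_adj' _ _ _ _).1 hxy
  exact h u v huv fun e => hne (Quotient.sound e)

theorem card_eq_sum_fiber {X I : Type*} [Finite X] [Fintype I] (F : X → I) :
    Nat.card X = ∑ i, Nat.card {x // F x = i} := by
  rw [← Nat.card_sigma]
  exact Nat.card_congr (Equiv.sigmaFiberEquiv F).symm

/-- No two adjacent vertices are equivalent. -/
def Proper {W : Type*} (K : SimpleGraph W) (π : Setoid W) : Prop := ∀ u v, K.Adj u v → ¬ π u v

/-- Any two equivalent vertices are joined by a path of equivalent vertices. -/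
def ConnectedClasses {W : Type*} (K : SimpleGraph W) (π : Setoid W) : Prop :=
  Relation.EqvGen.setoid (fun u v => K.Adj u v ∧ π u v) = π

-- Sort the homomorphisms by kernel: the classes are independent because `G` has no loops, and the
-- induced map on the quotient is injective.
open Classical in
theorem hom_eq_sum_inj {W X : Type*} [Finite W] [Finite X] (K : SimpleGraph W)
    (G : SimpleGraph X) :
    hom K G = ∑ π : Setoid W, if Proper K π then inj (quot K π) G else 0 := by
  rw [hom_eq_relHom, relHom, card_eq_sum_fiber (fun φ => Setoid.ker φ.1)]
  refine Finset.sum_congr rfl fun π _ => ?_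
  split_ifs with h
  · rw [inj_eq_card, relHom_quot]
    refine Nat.card_congr
      { toFun := fun φ => ⟨Quotient.lift φ.1.1 fun a b hab => ?_, ?_, ?_⟩
        invFun := fun ψ => ⟨⟨fun u => ψ.1 ⟦u⟧, ?_⟩, ?_⟩
        left_inv := fun φ => rfl
        right_inv := fun ψ => ?_ }
    · have : Setoid.ker φ.1.1 a b := by rw [φ.2]; exact hab
      exact this
    · intro x y
      induction x using Quotient.inductionOn
      induction y using Quotient.inductionOn
      intro hxy
      refine Quotient.sound ?_
      have : Setoid.ker φ.1.1 _ _ := hxy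
      rwa [φ.2] at this
    · intro u v huv _
      exact φ.1.2 u v huv
    · intro u v huv
      exact ψ.2.2 u v huv (h u v huv)
    · ext u v
      exact ⟨fun e => Quotient.exact (ψ.2.1 e), fun e => congrArg ψ.1 (Quotient.sound e)⟩
    · refine Subtype.ext (funext fun x => ?_)
      induction x using Quotient.inductionOn
      rfl
  · rw [Nat.card_eq_zero]
    left
    constructor
    rintro ⟨⟨φ, hφ⟩, rfl⟩
    refine h fun u v huv e => (hφ u v huv).ne e

-- Sort the maps by the equivalence relation that their contracted edges generate. Its classes are
-- connected, and no edge between different classes is contracted, so the induced map is a genuine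
-- homomorphism.
open Classical in
theorem weakHom_eq_sum_hom {W X : Type*} [Finite W] [Finite X] (K : SimpleGraph W)
    (G : SimpleGraph X) :
    weakHom K G = ∑ π : Setoid W, if ConnectedClasses K π then hom (quot K π) G else 0 := by
  rw [weakHom, relHom, card_eq_sum_fiber
    (fun φ => Relation.EqvGen.setoid fun u v => K.Adj u v ∧ φ.1 u = φ.1 v)]
  refine Finset.sum_congr rfl fun π _ => ?_
  split_ifs with h
  · have h1 := relHom_quot K π G.Adj (fun _ => True)
    simp only [true_and] at h1
    rw [hom_eq_relHom, relHom, h1]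
    refine Nat.card_congr
      { toFun := fun φ => ⟨Quotient.lift φ.1.1 fun a b hab => ?_, ?_⟩
        invFun := fun ψ => ⟨⟨fun u => ψ.1 ⟦u⟧, ?_⟩, ?_⟩
        left_inv := fun φ => rfl
        right_inv := fun ψ => ?_ }
    · have hle : Relation.EqvGen.setoid (fun u v => K.Adj u v ∧ φ.1.1 u = φ.1.1 v) ≤
          Setoid.ker φ.1.1 := Setoid.eqvGen_le fun _ _ h => h.2
      rw [φ.2] at hle
      exact hle hab
    · intro u v huv hπ
      refine (φ.1.2 u v huv).resolve_left fun e => hπ ?_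
      rw [← φ.2]
      exact Relation.EqvGen.rel _ _ ⟨huv, e⟩
    · intro u v huv
      by_cases hπ : π u v
      · exact Or.inl (congrArg ψ.1 (Quotient.sound hπ))
      · exact Or.inr (ψ.2 u v huv hπ)
    -- A homomorphism on the quotient contracts exactly the edges inside classes, so the contracted
    -- edges generate `π` again.
    · refine Eq.trans ?_ h
      congr 1
      ext u v
      refine and_congr_right fun huv => ⟨fun e => ?_, fun e => congrArg ψ.1 (Quotient.sound e)⟩
      by_contra hπ
      exact (ψ.2 u v huv hπ).ne e
    · refine Subtype.ext (funext fun x => ?_)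
      induction x using Quotient.inductionOn
      rfl
  · rw [Nat.card_eq_zero]
    left
    constructor
    rintro ⟨⟨φ, hφ⟩, rfl⟩
    refine h (le_antisymm (Setoid.eqvGen_le fun _ _ e => e.2) (Setoid.eqvGen_le fun u v e => ?_))
    exact Relation.EqvGen.rel _ _ ⟨e.1, Relation.EqvGen.rel _ _ e⟩

theorem inj_quot_bot {W X : Type*} (K : SimpleGraph W) (G : SimpleGraph X) :
    inj (quot K ⊥) G = inj K G := by
  rw [inj_eq_card, relHom_quot, inj_eq_card]
  have hb : Function.Bijective (Quotient.mk (⊥ : Setoid W)) :=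
    ⟨fun a b h => Quotient.exact h, Quotient.mk_surjective⟩
  let e : W ≃ Quotient (⊥ : Setoid W) := Equiv.ofBijective _ hb
  refine Nat.card_congr ((Equiv.arrowCongr e.symm (Equiv.refl X)).subtypeEquiv fun ψ => ?_)
  have he : (Equiv.arrowCongr e.symm (Equiv.refl X)) ψ = ψ ∘ e := rfl
  rw [he, e.injective_comp]
  refine and_congr_right fun _ => ⟨fun h u v huv => h u v huv fun e => huv.ne e,
    fun h u v huv _ => h u v huv⟩

theorem card_quotient_lt {W : Type*} [Finite W] {π : Setoid W} (h : π ≠ ⊥) :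
    Nat.card (Quotient π) < Nat.card W := by
  have := Fintype.ofFinite W
  have := Fintype.ofFinite (Quotient π)
  rw [Nat.card_eq_fintype_card, Nat.card_eq_fintype_card]
  refine Fintype.card_lt_of_surjective_not_injective (Quotient.mk π) Quotient.mk_surjective
    fun hinj => h ?_
  ext u v
  exact ⟨fun e => hinj (Quotient.sound e), fun e => by cases e; exact π.refl _⟩

open Classical in
theorem injParam_eq {W : Type*} [Finite W] (K : SimpleGraph W) :
    injParam K = homParam K -
      ∑ π ∈ Finset.univ.filter (fun π : Setoid W => Proper K π ∧ π ≠ ⊥), injParam (quot K π) := by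
  funext n G
  have hp : Proper K ⊥ := fun u v huv e => huv.ne e
  simp only [injParam, homParam, Pi.sub_apply, Finset.sum_apply]
  rw [hom_eq_sum_inj, ← Finset.sum_filter, ← Finset.sum_erase_add _ _
    (Finset.mem_filter.2 ⟨Finset.mem_univ ⊥, hp⟩), inj_quot_bot]
  have : (Finset.univ.filter (fun π : Setoid W => Proper K π)).erase ⊥ =
      Finset.univ.filter (fun π : Setoid W => Proper K π ∧ π ≠ ⊥) := by
    ext π
    simp [and_comm]
  rw [this]
  push_cast
  ring

/-- The homomorphism counts of graphs with fewer than `m` vertices. -/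
def smallerHoms (m : ℕ) : Set Param :=
  {f | ∃ (W : Type u) (_ : Finite W) (K : SimpleGraph W), Nat.card W < m ∧ f = homParam K}

/-- The nontrivial quotients in `injParam_eq` have fewer vertices, so induction on the number of
vertices applies to them. -/
theorem injParam_sub_homParam_mem {W : Type u} [Finite W] (K : SimpleGraph W) :
    injParam K - homParam K ∈ Submodule.span ℤ (smallerHoms.{u} (Nat.card W)) := by
  classical
  obtain ⟨m, hm⟩ : ∃ m, m = Nat.card W := ⟨_, rfl⟩
  induction m using Nat.strong_induction_on generalizing W with
  | _ m ih =>
    rw [injParam_eq, sub_sub_cancel_left, neg_mem_iff]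
    refine Submodule.sum_mem _ fun π hπ => ?_
    have hlt := card_quotient_lt (Finset.mem_filter.1 hπ).2.2
    have h1 := ih _ (hm ▸ hlt) (quot K π) rfl
    have h2 := Submodule.span_mono (R := ℤ) (show smallerHoms.{u} (Nat.card (Quotient π)) ⊆
      smallerHoms (Nat.card W) from fun f ⟨W', hW', K', hK', e⟩ =>
        ⟨W', hW', K', hK'.trans hlt, e⟩) h1
    rw [← sub_add_cancel (injParam (quot K π)) (homParam (quot K π))]
    exact add_mem h2 (Submodule.subset_span ⟨_, inferInstance, _, hlt, rfl⟩)

theorem relHom_true {W : Type*} [Finite W] (K : SimpleGraph W) :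
    relHom K (fun _ _ : Fin 2 => True) = 2 ^ Nat.card W := by
  have := Fintype.ofFinite W
  rw [relHom, Nat.card_congr (Equiv.subtypeUnivEquiv fun _ => by simp), Nat.card_fun]
  simp

/-- The full relation on two points, loops included, admits all `2 ^ |W|` maps. -/
theorem distinguished_of_card_ne {W W' : Type*} [Finite W] [Finite W'] (K : SimpleGraph W)
    (K' : SimpleGraph W') (h : Nat.card W ≠ Nat.card W') : Distinguished K K' := by
  refine ⟨⟨2, by norm_num, fun _ _ => True, fun _ _ _ => trivial, ⊥⟩, rfl, ?_⟩
  change relHom K (fun _ _ : Fin 2 => True) ≠ relHom K' (fun _ _ : Fin 2 => True)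
  rw [relHom_true, relHom_true]
  exact fun e => h (Nat.pow_right_injective le_rfl e)

theorem smallerHoms_subset {W : Type u} [Finite W] (K : SimpleGraph W) :
    smallerHoms.{u} (Nat.card W) ⊆ otherHoms K := by
  rintro f ⟨W', _, K', hlt, rfl⟩
  exact ⟨W', K', distinguished_of_card_ne _ _ hlt.ne, rfl⟩

end SubgraphCount

namespace SubgraphCount

universe u

/-! ### Inclusion and exclusion over supergraphs -/

/-- The edges of the complement of `H`. -/
noncomputable def nonEdges {V : Type*} [Finite V] (H : SimpleGraph V) : Finset (Sym2 V) :=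
  (Set.toFinite Hᶜ.edgeSet).toFinset

/-- The supergraph of `H` with the additional edges `S`. -/
def addEdges {V : Type*} (H : SimpleGraph V) (S : Finset (Sym2 V)) : SimpleGraph V :=
  H ⊔ SimpleGraph.fromEdgeSet S

/-- Makes the sign of a supergraph in the inclusion–exclusion formula a function of its number of
edges. -/
theorem edgeSet_addEdges {V : Type*} [Finite V] {H : SimpleGraph V} {S : Finset (Sym2 V)}
    (hS : S ⊆ nonEdges H) : (addEdges H S).edgeSet.ncard = H.edgeSet.ncard + S.card := by
  classical
  have hS' : ∀ e ∈ S, e ∈ Hᶜ.edgeSet := fun e he => by simpa [nonEdges] using hS he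
  have hdiag : (S : Set (Sym2 V)) \ Sym2.diagSet = S := by
    ext e
    refine ⟨fun h => h.1, fun h => ⟨h, fun hd => ?_⟩⟩
    exact Hᶜ.not_isDiag_of_mem_edgeSet (hS' e h) (by simpa using hd)
  rw [addEdges, SimpleGraph.edgeSet_sup, SimpleGraph.edgeSet_fromEdgeSet, hdiag,
    Set.ncard_union_eq ?_ (Set.toFinite _) (Set.toFinite _), Set.ncard_coe_finset]
  rw [Set.disjoint_left]
  intro e he hS
  have := hS' e hS
  induction e with
  | _ a b => exact ((SimpleGraph.compl_adj _ _ _).1 this).2 he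

theorem exists_addEdges {V : Type*} [Finite V] {H K : SimpleGraph V} (h : H ≤ K) :
    ∃ S ⊆ nonEdges H, addEdges H S = K := by
  classical
  refine ⟨(Set.toFinite (K.edgeSet \ H.edgeSet)).toFinset, ?_, ?_⟩
  · intro e he
    simp only [nonEdges, Set.Finite.mem_toFinset, Set.mem_sdiff] at he ⊢
    induction e with
    | _ a b =>
      exact (SimpleGraph.compl_adj _ _ _).2 ⟨K.ne_of_adj he.1, he.2⟩
  · ext a b
    have := @h a b
    simp only [addEdges, SimpleGraph.sup_adj, SimpleGraph.fromEdgeSet_adj, Set.Finite.coe_toFinset,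
      Set.mem_sdiff, SimpleGraph.mem_edgeSet]
    constructor
    · rintro (h | h)
      · exact this h
      · exact h.1.1
    · intro hK
      by_cases hH : H.Adj a b
      · exact Or.inl hH
      · exact Or.inr ⟨⟨hK, hH⟩, hK.ne⟩

/-- The number of induced copies as a graph parameter. -/
noncomputable def indParam {W : Type*} (K : SimpleGraph W) : Param := fun _ G => ind K G

theorem card_subtype_eq_sum {X : Type*} [Fintype X] (p : X → Prop) [DecidablePred p] :
    ((Nat.card {x // p x} : ℕ) : ℤ) = ∑ x, if p x then 1 else 0 := by
  rw [Nat.card_eq_fintype_card, Fintype.card_subtype, Finset.card_filter]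
  push_cast
  rfl

/-- Fix an injective homomorphism `φ` of `H` and let `C` be the non-edges of `H` that `φ` maps to
edges. Then `φ` is counted for the subsets of `C`, whose alternating sum vanishes unless `C` is
empty, that is, unless `φ` is induced. -/
theorem indParam_eq {V : Type*} [Finite V] (H : SimpleGraph V) :
    indParam H = ∑ S ∈ (nonEdges H).powerset, (-1 : ℤ) ^ S.card • injParam (addEdges H S) := by
  classical
  have := Fintype.ofFinite V
  funext n G
  simp only [Finset.sum_apply, Pi.smul_apply, indParam, injParam, ind_eq_card, inj_eq_card,
    card_subtype_eq_sum, smul_eq_mul, Finset.mul_sum]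
  rw [Finset.sum_comm]
  refine Finset.sum_congr rfl fun φ _ => ?_
  by_cases hφ : Function.Injective φ ∧ ∀ u v, H.Adj u v → G.Adj (φ u) (φ v)
  swap
  · rw [if_neg fun h => hφ ⟨h.1, fun u v => (h.2 u v).2⟩]
    refine (Finset.sum_eq_zero fun S _ => ?_).symm
    rw [if_neg fun h => hφ ⟨h.1, fun u v huv => h.2 u v (Or.inl huv)⟩, mul_zero]
  obtain ⟨hinj, hhom⟩ := hφ
  set C := (nonEdges H).filter fun e => e ∈ (G.comap φ).edgeSet with hC
  have hsub : ∀ S ∈ (nonEdges H).powerset,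
      (-1 : ℤ) ^ S.card * (if Function.Injective φ ∧
        ∀ u v, (addEdges H S).Adj u v → G.Adj (φ u) (φ v) then 1 else 0) =
      if S ⊆ C then (-1 : ℤ) ^ S.card else 0 := by
    intro S hS
    have hiff : (Function.Injective φ ∧ ∀ u v, (addEdges H S).Adj u v → G.Adj (φ u) (φ v)) ↔
        S ⊆ C := by
      constructor
      · rintro ⟨-, h⟩ e he
        refine Finset.mem_filter.2 ⟨Finset.mem_powerset.1 hS he, ?_⟩
        have hne := Finset.mem_powerset.1 hS he
        induction e with
        | _ a b =>
          have hab : Hᶜ.Adj a b := by simpa [nonEdges] using hne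
          exact h a b (Or.inr ((SimpleGraph.fromEdgeSet_adj _).2 ⟨he, hab.ne⟩))
      · intro h
        refine ⟨hinj, fun u v huv => ?_⟩
        rcases huv with huv | huv
        · exact hhom u v huv
        · exact (Finset.mem_filter.1 (h ((SimpleGraph.fromEdgeSet_adj _).1 huv).1)).2
    simp only [hiff]
    split_ifs <;> simp
  rw [Finset.sum_congr rfl hsub, ← Finset.sum_filter]
  have hfil : (nonEdges H).powerset.filter (fun S => S ⊆ C) = C.powerset := by
    ext S
    simp only [Finset.mem_filter, Finset.mem_powerset]
    exact ⟨fun h => h.2, fun h => ⟨h.trans (Finset.filter_subset _ _), h⟩⟩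
  rw [hfil, Finset.sum_powerset_neg_one_pow_card]
  have hiff : (Function.Injective φ ∧ ∀ u v, G.Adj (φ u) (φ v) ↔ H.Adj u v) ↔ C = ∅ := by
    constructor
    · rintro ⟨-, h⟩
      refine Finset.filter_eq_empty_iff.2 fun e he hG => ?_
      induction e with
      | _ a b =>
        have hab : Hᶜ.Adj a b := by simpa [nonEdges] using he
        exact ((SimpleGraph.compl_adj _ _ _).1 hab).2 ((h a b).1 hG)
    · intro h
      refine ⟨hinj, fun u v => ⟨fun hG => ?_, hhom u v⟩⟩
      by_contra hH
      have hne : u ≠ v := fun e => hG.ne (congrArg φ e)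
      have hmem : s(u, v) ∈ nonEdges H := by
        simpa [nonEdges] using ⟨hne, hH⟩
      exact Finset.filter_eq_empty_iff.1 h hmem hG
  simp only [hiff]

/-! ### Graphs with the same homomorphism counts -/

theorem relHom_eq_of_not_distinguished {W W' : Type*} {K : SimpleGraph W} {K' : SimpleGraph W'}
    (h : ¬ Distinguished K K') {m : ℕ} (hm : 0 < m) (r : Fin m → Fin m → Prop)
    (hr : ∀ a b, r a b → r b a) : relHom K r = relHom K' r := by
  by_contra hne
  exact h ⟨⟨m, hm, r, hr, ⊥⟩, rfl, hne⟩

theorem homParam_eq_of_not_distinguished {W W' : Type*} [Finite W] [Finite W']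
    {K : SimpleGraph W} {K' : SimpleGraph W'} (h : ¬ Distinguished K K') : homParam K = homParam K' := by
  funext n G
  rw [homParam, homParam, hom_eq_relHom, hom_eq_relHom]
  -- Patterns are nonempty, so an empty target is treated apart: there the edge condition is vacuous
  -- and equality of the vertex numbers suffices.
  rcases Nat.eq_zero_or_pos n with rfl | hn
  · congr 1
    obtain ⟨e⟩ : Nonempty (W ≃ W') := by
      rw [← Finite.card_eq]
      by_contra hne
      exact h (distinguished_of_card_ne K K' hne)
    exact Nat.card_congr ((Equiv.arrowCongr e
      (Equiv.refl (Fin 0))).subtypeEquiv fun φ =>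
        ⟨fun _ u => (Equiv.arrowCongr e (Equiv.refl (Fin 0)) φ u).elim0,
          fun _ u => (φ u).elim0⟩)
  · rw [relHom_eq_of_not_distinguished h hn G.Adj fun _ _ h => h.symm]

/-- Lovász's argument: the numbers of homomorphisms to `K'` with image inside `T` agree for the
sources `K` and `K'`, as they count homomorphisms to an induced subgraph. Hence so do the numbers
with image exactly `T`. For `T` the whole vertex set, the identity of `K'` is counted. -/
theorem exists_surjective_hom {V : Type*} [Finite V] [Nonempty V] {K K' : SimpleGraph V}
    (h : ¬ Distinguished K K') :
    ∃ φ : V → V, Function.Surjective φ ∧ ∀ u v, K.Adj u v → K'.Adj (φ u) (φ v) := by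
  classical
  have := Fintype.ofFinite V
  -- The argument is the source; the target is always `K'`.
  let homs : SimpleGraph V → Finset (V → V) := fun K =>
    Finset.univ.filter fun φ => ∀ u v, K.Adj u v → K'.Adj (φ u) (φ v)
  let into : SimpleGraph V → Finset V → ℕ := fun K T =>
    ((homs K).filter fun φ => ∀ u, φ u ∈ T).card
  let onto : SimpleGraph V → Finset V → ℕ := fun K T =>
    ((homs K).filter fun φ => Finset.univ.image φ = T).card
  have into_eq : ∀ T, into K T = into K' T := by
    intro T
    rcases T.eq_empty_or_nonempty with rfl | hT
    · have : ∀ K, into K ∅ = 0 := fun K => by simp [into]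
      rw [this, this]
    · have key : ∀ K : SimpleGraph V, into K T =
          relHom K fun x y : Fin T.card => K'.Adj (T.equivFin.symm x) (T.equivFin.symm y) := by
        intro K
        rw [relHom_congr (K' := K) (X' := T) (r' := fun x y => K'.Adj x y) .refl T.equivFin.symm
          fun _ _ => Iff.rfl]
        simp only [into, homs]
        rw [Finset.filter_filter, ← Fintype.card_subtype, ← Nat.card_eq_fintype_card]
        exact Nat.card_congr
          { toFun := fun φ => ⟨fun u => ⟨φ.1 u, φ.2.2 u⟩, φ.2.1⟩
            invFun := fun φ => ⟨fun u => φ.1 u, φ.2, fun u => (φ.1 u).2⟩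
            left_inv := fun _ => rfl
            right_inv := fun _ => rfl }
      rw [key, key]
      exact relHom_eq_of_not_distinguished h hT.card_pos _ fun _ _ h => h.symm
  have into_sum : ∀ K T, into K T = ∑ T' ∈ T.powerset, onto K T' := by
    intro K T
    rw [show into K T = ((homs K).filter fun φ => ∀ u, φ u ∈ T).card from rfl,
      Finset.card_eq_sum_card_fiberwise (f := fun φ => Finset.univ.image φ) (t := T.powerset)]
    · refine Finset.sum_congr rfl fun T' hT' => ?_
      simp only [onto]
      rw [Finset.filter_filter]
      congr 1
      refine Finset.filter_congr fun φ _ => ⟨fun h => h.2, fun h => ⟨fun u => ?_, h⟩⟩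
      exact Finset.mem_powerset.1 hT' (h ▸ Finset.mem_image_of_mem φ (Finset.mem_univ u))
    · intro φ hφ
      have := (Finset.mem_filter.1 hφ).2
      exact Finset.mem_coe.2 (Finset.mem_powerset.2 (Finset.image_subset_iff.2 fun u _ => this u))
  have onto_eq : ∀ T, onto K T = onto K' T := by
    intro T
    induction T using Finset.strongInduction with
    | _ T ih =>
      have h1 := into_eq T
      rw [into_sum, into_sum, ← Finset.sum_erase_add _ _ (Finset.mem_powerset_self T),
        ← Finset.sum_erase_add _ _ (Finset.mem_powerset_self T)] at h1
      have h2 : ∀ T' ∈ T.powerset.erase T, onto K T' = onto K' T' := fun T' hT' =>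
        ih T' (Finset.mem_ssubsets.1 hT')
      rw [Finset.sum_congr rfl h2] at h1
      exact Nat.add_left_cancel h1
  have hpos : 0 < onto K Finset.univ := by
    rw [onto_eq]
    refine Finset.card_pos.2 ⟨id, ?_⟩
    simp [homs]
  obtain ⟨φ, hφ⟩ := Finset.card_pos.1 hpos
  rw [Finset.mem_filter, Finset.mem_filter] at hφ
  refine ⟨φ, fun v => ?_, hφ.1.2⟩
  obtain ⟨u, -, hu⟩ := Finset.mem_image.1 (hφ.2 ▸ Finset.mem_univ v)
  exact ⟨u, hu⟩

theorem Distinguished.symm {W W' : Type*} {K : SimpleGraph W} {K' : SimpleGraph W'}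
    (h : Distinguished K K') : Distinguished K' K := by
  obtain ⟨P, hP, hne⟩ := h
  exact ⟨P, hP, hne.symm⟩

/-- A surjective homomorphism on a finite vertex set is bijective, hence injective on edges. Used in
both directions, this gives equality. -/
theorem ncard_edgeSet_le {V : Type*} [Finite V] {K K' : SimpleGraph V}
    (h : ¬ Distinguished K K') : K.edgeSet.ncard ≤ K'.edgeSet.ncard := by
  rcases isEmpty_or_nonempty V with hV | hV
  · rw [Subsingleton.elim K K']
  obtain ⟨φ, hφ, hhom⟩ := exists_surjective_hom h
  have hinj : Function.Injective φ := Finite.injective_iff_surjective.2 hφ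
  refine Set.ncard_le_ncard_of_injOn (Sym2.map φ) ?_ (Sym2.map.injective hinj).injOn
    (Set.toFinite _)
  intro e he
  induction e with
  | _ a b => exact hhom a b he

/-! ### The equivalence -/

/-- Modulo graphs that can be told from the target, `ind H` is a multiple of its homomorphism count:
smaller quotients differ in their number of vertices, and indistinguishable supergraphs all carry
the sign `(-1) ^ S₀.card`. -/
theorem homEasy_of_indEasy {V : Type u} [Finite V] {H : SimpleGraph V} (hH : IndEasy H)
    {K : SimpleGraph V} (hK : H ≤ K) : HomEasy K := by
  classical
  obtain ⟨S₀, hS₀, rfl⟩ := exists_addEdges hK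
  set same := (nonEdges H).powerset.filter fun S =>
    ¬ Distinguished (addEdges H S) (addEdges H S₀) with hsame
  have card_same : ∀ S ∈ same, S.card = S₀.card := by
    intro S hS
    obtain ⟨hS1, hS2⟩ := Finset.mem_filter.1 hS
    have h1 := ncard_edgeSet_le hS2
    have h2 := ncard_edgeSet_le fun h => hS2 h.symm
    rw [edgeSet_addEdges hS₀, edgeSet_addEdges (Finset.mem_powerset.1 hS1)] at h1 h2
    omega
  have hmem : S₀ ∈ same := Finset.mem_filter.2
    ⟨Finset.mem_powerset.2 hS₀, fun ⟨_, _, hne⟩ => hne rfl⟩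
  have hcard : (same.card : ℤ) ≠ 0 := by exact_mod_cast (Finset.card_pos.2 ⟨_, hmem⟩).ne'
  refine homEasy_of_mem_easyGroup _ (IsEasy.mem_easyGroup hH)
    (a := (-1) ^ S₀.card * same.card) (mul_ne_zero (by simp) hcard) ?_
  change indParam H - _ ∈ _
  have hsum : ((-1 : ℤ) ^ S₀.card * same.card) • homParam (addEdges H S₀) =
      ∑ S ∈ same, (-1 : ℤ) ^ S.card • homParam (addEdges H S) := by
    rw [Finset.sum_congr rfl fun S hS => by
      rw [card_same S hS, homParam_eq_of_not_distinguished (Finset.mem_filter.1 hS).2],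
      Finset.sum_const, mul_smul, smul_comm, ← natCast_zsmul]
  rw [indParam_eq, hsum, ← Finset.sum_filter_add_sum_filter_not (nonEdges H).powerset
    (fun S => ¬ Distinguished (addEdges H S) (addEdges H S₀)), add_sub_right_comm,
    ← Finset.sum_sub_distrib]
  have hsmall : ∀ S : Finset (Sym2 V), injParam (addEdges H S) - homParam (addEdges H S) ∈
      Submodule.span ℤ (otherHoms (addEdges H S₀)) := fun S =>
    Submodule.span_mono (smallerHoms_subset _) (injParam_sub_homParam_mem _)
  refine add_mem (Submodule.sum_mem _ fun S _ => ?_) (Submodule.sum_mem _ fun S hS => ?_)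
  · rw [← smul_sub]
    exact Submodule.smul_mem _ _ (hsmall S)
  · refine Submodule.smul_mem _ _ ?_
    rw [← sub_add_cancel (injParam (addEdges H S)) (homParam (addEdges H S))]
    exact add_mem (hsmall S) (Submodule.subset_span
      ⟨V, _, not_not.1 (Finset.mem_filter.1 hS).2, rfl⟩)

/-- Supergraphs of `H` alone do not include its quotients; counting maps that may contract edges
brings these in with positive coefficients, so nothing cancels. -/
theorem homEasy_of_surjective {V W : Type u} [Finite V] {H : SimpleGraph V}
    (hH : ∀ K, H ≤ K → HomEasy K) {Q : SimpleGraph W} {f : V → W} (hf : Function.Surjective f)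
    (hhom : ∀ u v, H.Adj u v → Q.Adj (f u) (f v)) : HomEasy Q := by
  classical
  have : Finite W := Finite.of_surjective f hf
  -- The largest graph that `f` maps to `Q` up to contraction: fibers are cliques, so contracting
  -- them is among the partitions with connected classes.
  let K : SimpleGraph V :=
    { Adj := fun u v => u ≠ v ∧ (f u = f v ∨ Q.Adj (f u) (f v))
      symm := ⟨fun _ _ h => ⟨h.1.symm, h.2.imp Eq.symm fun h => h.symm⟩⟩
      loopless := ⟨fun _ h => h.1 rfl⟩ }
  have hK : HomEasy K := hH K fun u v huv => ⟨huv.ne, Or.inr (hhom u v huv)⟩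
  let e : quot K (Setoid.ker f) ≃g Q :=
    { toEquiv := Setoid.quotientKerEquivOfSurjective f hf
      map_rel_iff' := by
        intro x y
        induction x using Quotient.inductionOn with
        | _ a =>
        induction y using Quotient.inductionOn with
        | _ b =>
        change Q.Adj (f a) (f b) ↔ _
        constructor
        · intro hab
          exact quot_adj ⟨fun e => hab.ne (congrArg f e), Or.inr hab⟩ fun e => hab.ne e
        · intro hab
          obtain ⟨hne, u, v, huv, hu, hv⟩ := (SimpleGraph.map_adj' _ _ _ _).1 hab
          have hu' : f u = f a := Quotient.exact hu
          have hv' : f v = f b := Quotient.exact hv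
          rw [← hu', ← hv']
          refine huv.2.resolve_left fun h => hne (Quotient.sound ?_)
          change f a = f b
          rw [← hu', ← hv', h] }
  have hrel : ∀ {X : Type} (r : X → X → Prop),
      relHom (quot K (Setoid.ker f)) r = relHom Q r := fun r =>
    relHom_congr e (.refl _) fun _ _ => Iff.rfl
  have hconn : ConnectedClasses K (Setoid.ker f) := by
    refine le_antisymm (Setoid.eqvGen_le fun _ _ h => h.2) fun u v huv => ?_
    by_cases huv' : u = v
    · subst huv'
      exact Relation.EqvGen.refl _
    · exact Relation.EqvGen.rel _ _ ⟨⟨huv', Or.inl huv⟩, huv⟩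
  -- Enough colours for a proper colouring of `K`, and positive even if `V` is empty.
  set m := Nat.card V + 1 with hm
  have hcol : 0 < relHom K fun a b : Fin m => a ≠ b := by
    obtain ⟨i⟩ : Nonempty (V ↪ Fin m) := by
      have := Fintype.ofFinite V
      refine Function.Embedding.nonempty_of_card_le ?_
      rw [Fintype.card_fin, hm, Nat.card_eq_fintype_card]
      omega
    have : Nonempty {φ : V → Fin m // ∀ u v, K.Adj u v → φ u ≠ φ v} :=
      ⟨⟨i, fun u v huv e => huv.ne (i.injective e)⟩⟩
    exact Nat.card_pos
  set c : ℤ := ((relHom K fun a b : Fin m => a ≠ b : ℕ) : ℤ) with hc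
  have hc0 : c ≠ 0 := Int.natCast_ne_zero.2 hcol.ne'
  have hmem := comp_mem_easyGroup (IsEasy.mem_easyGroup hK) (Pattern.complete m (Nat.succ_pos _))
  set conn := (Finset.univ : Finset (Setoid V)).filter fun π => ConnectedClasses K π with hconn'
  set same := conn.filter fun π => ¬ Distinguished (quot K π) Q with hsame
  have hparam : Param.comp (fun n G => (hom K G : ℤ)) (Pattern.complete m (Nat.succ_pos _)) =
      c • ∑ π ∈ conn, homParam (quot K π) := by
    funext n G
    simp only [Param.comp, hom_finProd_complete, weakHom_eq_sum_hom, ← Finset.sum_filter,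
      Pi.smul_apply, Finset.sum_apply, homParam, smul_eq_mul]
    push_cast
    rw [mul_comm]
  rw [hparam] at hmem
  have hker : Setoid.ker f ∈ same := by
    refine Finset.mem_filter.2 ⟨Finset.mem_filter.2 ⟨Finset.mem_univ _, hconn⟩, ?_⟩
    rintro ⟨P, -, hne⟩
    exact hne (hrel _)
  have hsame0 : (same.card : ℤ) ≠ 0 := by exact_mod_cast (Finset.card_pos.2 ⟨_, hker⟩).ne'
  refine homEasy_of_mem_easyGroup Q hmem (mul_ne_zero hc0 hsame0) ?_
  have hsum : (same.card : ℤ) • homParam Q = ∑ π ∈ same, homParam (quot K π) := by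
    have heq : ∀ π ∈ same, homParam (quot K π) = homParam Q := fun π hπ =>
      homParam_eq_of_not_distinguished (Finset.mem_filter.1 hπ).2
    rw [Finset.sum_congr rfl heq, Finset.sum_const, ← natCast_zsmul]
  rw [mul_smul, hsum, ← smul_sub, ← Finset.sum_filter_add_sum_filter_not conn
    (fun π => ¬ Distinguished (quot K π) Q), add_sub_cancel_left]
  refine Submodule.smul_mem _ _ (Submodule.sum_mem _ fun π hπ => Submodule.subset_span ?_)
  exact ⟨_, _, not_not.1 (Finset.mem_filter.1 hπ).2, rfl⟩

/-- Stated for all surjective images of `H`, not just supergraphs, since this class is closed under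
the proper quotients needed in the induction. -/
theorem injEasy_of_surjective {V : Type u} [Finite V] {H : SimpleGraph V}
    (hH : ∀ K, H ≤ K → HomEasy K) {W : Type u} [Finite W] (Q : SimpleGraph W) {f : V → W}
    (hf : Function.Surjective f) (hhom : ∀ u v, H.Adj u v → Q.Adj (f u) (f v)) : InjEasy Q := by
  classical
  obtain ⟨m, hm⟩ : ∃ m, m = Nat.card W := ⟨_, rfl⟩
  induction m using Nat.strong_induction_on generalizing W with
  | _ m ih =>
    refine isEasy_of_mem ?_
    change injParam Q ∈ easyGroup
    rw [injParam_eq]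
    refine sub_mem (IsEasy.mem_easyGroup (homEasy_of_surjective hH hf hhom))
      (sum_mem fun π hπ => ?_)
    obtain ⟨-, hp, hne⟩ := Finset.mem_filter.1 hπ
    exact IsEasy.mem_easyGroup (ih _ (hm ▸ card_quotient_lt hne) (quot Q π)
      (Quotient.mk_surjective.comp hf)
      (fun u v huv => quot_adj (hhom u v huv) (hp _ _ (hhom u v huv))) rfl)

theorem indEasy_of_injEasy {V : Type u} [Finite V] {H : SimpleGraph V}
    (hH : ∀ K, H ≤ K → InjEasy K) : IndEasy H := by
  refine isEasy_of_mem ?_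
  change indParam H ∈ easyGroup
  rw [indParam_eq]
  exact sum_mem fun S _ => zsmul_mem (IsEasy.mem_easyGroup (hH _ le_sup_left)) _

end SubgraphCount

theorem lemma1p12 {V : Type*} [Finite V] (H : SimpleGraph V) :
    List.TFAE [
      SubgraphCount.IndEasy H,
      ∀ H' : SimpleGraph V, H ≤ H' → SubgraphCount.InjEasy H',
      ∀ H' : SimpleGraph V, H ≤ H' → SubgraphCount.HomEasy H'] := by
  tfae_have 1 → 3 := fun h _ hK => SubgraphCount.homEasy_of_indEasy h hK
  tfae_have 3 → 2 := fun h H' hH' =>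
    SubgraphCount.injEasy_of_surjective h H' Function.surjective_id fun _ _ huv => hH' huv
  tfae_have 2 → 1 := SubgraphCount.indEasy_of_injEasy
  tfae_finish
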